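/- Let $R$ be a commutative Noetherian ring, $\mathfrak a$ an ideal of $R$, $M$ a finitely generated $R$-module, and $\mathcal S$ a Serre class of $R$-modules (a class containing $0$ and closed under submodules, quotients and extensions). A sequence $x_1,\dots,x_r$ in $R$ is a *weak $M$-sequence with respect to $\mathcal S$* if $\big((x_1,\dots,x_{i-1})M:_M x_i\big)/(x_1,\dots,x_{i-1})M\in\mathcal S$ for $i=1,\dots,r$, and an *$M$-sequence with respect to $\mathcal S$* if moreover $M/(x_1,\dots,x_r)M\notin\mathcal S$. Such a sequence of elements of $\mathfrak a$ is *maximal in $\mathfrak a$* if it is not a proper initial segment of another sequence of the same kind of elements of $\mathfrak a$. Let $\underline y=y_1,\dots,y_n$ be a finite system of generators of $\mathfrak a$, let $K_\bullet(\underline y)$ be its Koszul complex and $K^\bullet(\underline y,M)=\operatorname{Hom}_R(K_\bullet(\underline y),M)$. With $\inf\emptyset=+\infty$, put $$\mathcal S\text{-}H.\operatorname{grade}_R(\mathfrak a,M)=\inf\{i\ge 0: H^i_{\mathfrak a}(M)\notin\mathcal S\},\qquad \mathcal S\text{-}E.\operatorname{grade}_R(\mathfrak a,M)=\inf\{i\ge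 0:\operatorname{Ext}^i_R(R/\mathfrak a,M)\notin\mathcal S\},$$ $$\mathcal S\text{-}K.\operatorname{grade}_R(\mathfrak a,M)=\inf\{i\ge 0:H^i(K^\bullet(\underline y,M))\notin\mathcal S\},$$ and let $\mathcal S\text{-}C.\operatorname{grade}_R(\mathfrak a,M)$ be the supremum in $\mathbb N_0\cup\{\infty\}$ of the lengths of the weak $M$-sequences with respect to $\mathcal S$ of elements of $\mathfrak a$. Then the following hold. (i) If $x_1,\dots,x_r$ is a maximal weak $M$-sequence with respect to $\mathcal S$ in $\mathfrak a$, then $r=\mathcal S\text{-}E.\operatorname{grade}_R(\mathfrak a,M)$. (ii) $\mathcal S\text{-}C.\operatorname{grade}_R(\mathfrak a,M)=\mathcal S\text{-}E.\operatorname{grade}_R(\mathfrak a,M)=\mathcal S\text{-}K.\operatorname{grade}_R(\mathfrak a,M)$, the latter for every finite system $\underline y$ of generators of $\mathfrak a$. (iii) If $\mathcal S$ is closed under arbitrary direct sums, then $\mathcal S\text{-}E.\operatorname{grade}_R(\mathfrak a,M)=\mathcal S\text{-}H.\operatorname{grade}_R(\mathfrak a,M)$. (iv) If $M/\mathfrak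 aM\notin\mathcal S$, then $\mathcal S\text{-}K.\operatorname{grade}_R(\mathfrak a,M)<\infty$ and all maximal $M$-sequences with respect to $\mathcal S$ in $\mathfrak a$ have a common length. -/

import Mathlib

universe u

open CategoryTheory

noncomputable section

namespace SerreGrade

section Sequences

variable {R : Type u} [CommRing R] (S : ObjectProperty (ModuleCat.{u} R))
  (M : Type u) [AddCommGroup M] [Module R M]

/-- The submodule `(x₁, …, xₙ)M` of `M` generated by the products of the elements of a list. -/
def seqSubmodule (x : List R) : Submodule R M :=
  Ideal.ofList x • (⊤ : Submodule R M)

/-- The submodule `N :_M r = {m ∈ M | r m ∈ N}`. -/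
def colon {M : Type u} [AddCommGroup M] [Module R M] (N : Submodule R M) (r : R) :
    Submodule R M :=
  N.comap (LinearMap.lsmul R M r)

/-- `x = x₁, …, xₙ` is a weak `M`-sequence with respect to `S`: for each `i` the module
`((x₁, …, xᵢ₋₁)M :_M xᵢ) / (x₁, …, xᵢ₋₁)M` belongs to `S`. -/
def IsWeakSeq (x : List R) : Prop :=
  ∀ (i : ℕ) (hi : i < x.length),
    S (ModuleCat.of R
      (colon (seqSubmodule M (x.take i)) x[i] ⧸
        (seqSubmodule M (x.take i)).submoduleOf (colon (seqSubmodule M (x.take i)) x[i])))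

/-- `x` is an `M`-sequence with respect to `S`: a weak one with `M / xM ∉ S`. -/
def IsSeq (x : List R) : Prop :=
  IsWeakSeq S M x ∧ ¬ S (ModuleCat.of R (M ⧸ seqSubmodule M x))

/-- A maximal element, for extension of sequences, among the sequences of elements of the
ideal `a` that satisfy `P`. -/
def IsMaximalIn (a : Ideal R) (P : List R → Prop) (x : List R) : Prop :=
  (∀ r ∈ x, r ∈ a) ∧ P x ∧
    ∀ y : List R, (∀ r ∈ y, r ∈ a) → P y → x <+: y → y = x

/-- The Serre class (or any class of modules) `S` is closed under arbitrary direct sums. -/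
def ClosedUnderDirectSums : Prop :=
  ∀ (ι : Type u) (N : ι → ModuleCat.{u} R), (∀ i, S (N i)) →
    S (ModuleCat.of R (DirectSum ι fun i => N i))

end Sequences

section Koszul

variable {R : Type u} [CommRing R]

/-- The differential `⋀ⁱ⁺¹ E → ⋀ⁱ E` of the Koszul complex of a linear form `f : E → R`:
`v₀ ∧ ⋯ ∧ vᵢ ↦ ∑ₖ (-1)ᵏ f(vₖ) v₀ ∧ ⋯ ∧ v̂ₖ ∧ ⋯ ∧ vᵢ`. -/
def koszulD {E : Type u} [AddCommGroup E] [Module R E] (f : E →ₗ[R] R) (i : ℕ) :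
    (⋀[R]^(i + 1) E) →ₗ[R] (⋀[R]^i E) :=
  exteriorPower.alternatingMapLinearEquiv
    (AlternatingMap.alternatizeUncurryFin (f.smulRight (exteriorPower.ιMulti R i)))

theorem koszulD_ιMulti {E : Type u} [AddCommGroup E] [Module R E] (f : E →ₗ[R] R) (i : ℕ)
    (v : Fin (i + 1) → E) :
    koszulD f i (exteriorPower.ιMulti R (i + 1) v) =
      ∑ k : Fin (i + 1), (-1 : ℤ) ^ (k : ℕ) • f (v k) • exteriorPower.ιMulti R i (k.removeNth v) := by
  simp [koszulD, AlternatingMap.alternatizeUncurryFin_apply]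

theorem koszulD_comp {E : Type u} [AddCommGroup E] [Module R E] (f : E →ₗ[R] R) (i : ℕ) :
    koszulD f i ∘ₗ koszulD f (i + 1) = 0 := by
  apply exteriorPower.linearMap_ext
  have h := AlternatingMap.alternatizeUncurryFin_alternatizeUncurryFinLM_comp_of_symmetric
    (f := f.smulRight (f.smulRight (exteriorPower.ιMulti R i (M := E))))
    (fun x y => by simp [smul_smul, mul_comm])
  ext1 v
  have hv := DFunLike.congr_fun h v
  rw [AlternatingMap.alternatizeUncurryFin_apply] at hv
  simp only [LinearMap.compAlternatingMap_apply, LinearMap.comp_apply, koszulD_ιMulti,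
    map_sum, map_zsmul, map_smul, LinearMap.zero_apply]
  refine Eq.trans (Finset.sum_congr rfl fun k _ => ?_) hv
  rw [LinearMap.comp_apply, AlternatingMap.alternatizeUncurryFinLM_apply,
    AlternatingMap.alternatizeUncurryFin_apply]
  congr 1
  rw [Finset.smul_sum]
  refine Finset.sum_congr rfl fun j _ => ?_
  rw [smul_comm (f (v k))]
  rfl

/-- The Koszul complex `K_•(y)` of a finite sequence `y = y₁, …, yₙ` in `R`: in degree `i` it is
`⋀ⁱ Rⁿ`, with the differential given by the linear form `eⱼ ↦ yⱼ`. -/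
def koszulComplex {n : ℕ} (y : Fin n → R) : ChainComplex (ModuleCat.{u} R) ℕ :=
  ChainComplex.of (fun i => ModuleCat.of R (⋀[R]^i (Fin n → R)))
    (fun i => ModuleCat.ofHom (koszulD (Fintype.linearCombination R y) i))
    (fun i => by rw [← ModuleCat.ofHom_comp, koszulD_comp]; rfl)

/-- The Koszul complex with coefficients, `K^•(y, M) = Hom_R(K_•(y), M)`. -/
def koszulCochain {n : ℕ} (y : Fin n → R) (M : Type u) [AddCommGroup M] [Module R M] :
    CochainComplex (ModuleCat.{u} R) ℕ :=
  (koszulComplex y).linearYonedaObj R (ModuleCat.of R M)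

end Koszul

section Grades

variable {R : Type u} [CommRing R] (S : ObjectProperty (ModuleCat.{u} R))
  (a : Ideal R) (M : Type u) [AddCommGroup M] [Module R M]

/-- The `H`-grade: the infimum (`⊤` if there is none) of the `i` such that the `i`-th local
cohomology module of `M` with support in `a` is not in `S`. -/
def hGrade : ℕ∞ :=
  sInf {e : ℕ∞ | ∃ i : ℕ, e = i ∧ ¬ S ((localCohomology a i).obj (ModuleCat.of R M))}

/-- The `E`-grade: the infimum (`⊤` if there is none) of the `i` such that `Extⁱ(R/a, M)` is not
in `S`. -/
def eGrade : ℕ∞ :=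
  sInf {e : ℕ∞ | ∃ i : ℕ, e = i ∧
    ¬ S (ModuleCat.of R (Abelian.Ext (ModuleCat.of R (R ⧸ a)) (ModuleCat.of R M) i))}

/-- The `K`-grade, computed with a finite sequence `y` (of generators of an ideal): the infimum
(`⊤` if there is none) of the `i` such that `Hⁱ(K^•(y, M))` is not in `S`. -/
def kGrade {n : ℕ} (y : Fin n → R) : ℕ∞ :=
  sInf {e : ℕ∞ | ∃ i : ℕ, e = i ∧ ¬ S ((koszulCochain y M).homology i)}

/-- The `C`-grade: the supremum of the lengths of the weak `M`-sequences with respect to `S`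
in `a` (the empty sequence is one). -/
def cGrade : ℕ∞ :=
  sSup {e : ℕ∞ | ∃ x : List R, (∀ r ∈ x, r ∈ a) ∧ IsWeakSeq S M x ∧ e = x.length}

end Grades

end SerreGrade

end

/-!
# Grades of finitely generated modules with respect to a Serre class

All the grades are computed by one argument. Write `P i M` for the property `Tⁱ(M) ∈ S`, where `T`
is `Ext(R ⧸ a, -)` or Koszul cohomology, and let `x ∈ a` be such that `(0 :_M x) ∈ S`. The long
exact sequences of `0 → (0 :_M x) → M → xM → 0` and `0 → xM → M → M / xM → 0`, together with the
facts that `T` preserves membership in `S` of finitely generated modules and that `x` acts as zero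
on `T`, show that `P 0 M` holds, that `P i (M / xM)` implies `P (i + 1) M`, and that `P i M` and
`P (i + 1) M` together imply `P i (M / xM)`. Hence for a weak sequence `xs` of length `r` in `a`, the properties `P i M` for
`i < n + r` are equivalent to the properties `P i (M / (xs)M)` for `i < n`. On the other hand, `P 0`
amounts to `(0 :_M a) ∈ S`, which by prime avoidance gives an `x ∈ a` with `(0 :_M x) ∈ S`, so that a
weak sequence can be extended as long as its length is less than the grade. This is the content of
`IsGradeFamily.cGrade_eq` and `IsGradeFamily.length_eq_of_isMaximalIn`; it is applied to
`isGradeFamily_ext` and `isGradeFamily_koszul`.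

For local cohomology, half of the same shifting argument shows that `Extⁱ(N, M) ∈ S` for `i` below
the grade and every finitely generated `N` annihilated by a power of `a` (`isVanishing_ext`). With `N = R ⧸ aᵐ`
this puts `Hⁱ(M)`, a quotient of the direct sum of the `Extⁱ(R ⧸ aᵐ, M)`, in `S` for `i` below the
grade. With `N` the kernel of `R ⧸ aᵐ → R ⧸ a`, it shows that the kernel of
`Extᵗ(R ⧸ a, M) → Hᵗ(M)` is in `S` for `t` the grade, so `Hᵗ(M)` is not
(`ext_mem_iff_localCohomology_mem`). Since Mathlib's local cohomology is built on `Ext` as a left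
derived functor, it has to be compared with `Abelian.Ext`, naturally in the first variable
(`extEquiv`, `extEquiv_naturality`).

Finally, the top Koszul cohomology module surjects onto `M / aM` (`mem_of_koszul_top`), so the grade
is finite when `M / aM ∉ S`; in that case every weak sequence in `a` is a sequence, and maximal
sequences are maximal weak sequences.
-/

noncomputable section

namespace SerreGrade

/-! ### Serre classes of modules -/

section Serre

variable {R : Type u} [CommRing R] (S : ObjectProperty (ModuleCat.{u} R)) [S.IsSerreClass]
  {A B C : Type u} [AddCommGroup A] [Module R A] [AddCommGroup B] [Module R B]
  [AddCommGroup C] [Module R C]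

theorem mem_of_injective (f : A →ₗ[R] B) (hf : Function.Injective f)
    (h : S (ModuleCat.of R B)) : S (ModuleCat.of R A) := by
  have : Mono (ModuleCat.ofHom f) := (ModuleCat.mono_iff_injective _).2 hf
  exact S.prop_of_mono (ModuleCat.ofHom f) h

theorem mem_of_surjective (f : A →ₗ[R] B) (hf : Function.Surjective f)
    (h : S (ModuleCat.of R A)) : S (ModuleCat.of R B) := by
  have : Epi (ModuleCat.ofHom f) := (ModuleCat.epi_iff_surjective _).2 hf
  exact S.prop_of_epi (ModuleCat.ofHom f) h

theorem mem_iff_of_equiv (e : A ≃ₗ[R] B) : S (ModuleCat.of R A) ↔ S (ModuleCat.of R B) :=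
  ⟨mem_of_surjective S e.toLinearMap e.surjective, mem_of_injective S e.toLinearMap e.injective⟩

theorem mem_of_exact (f : A →ₗ[R] B) (g : B →ₗ[R] C) (h : Function.Exact f g)
    (hA : S (ModuleCat.of R A)) (hC : S (ModuleCat.of R C)) : S (ModuleCat.of R B) :=
  S.prop_X₂_of_exact (S := ShortComplex.mk (ModuleCat.ofHom f) (ModuleCat.ofHom g)
      (by ext x; exact h.apply_apply_eq_zero x))
    ((ShortComplex.ShortExact.moduleCat_exact_iff_function_exact _).2 h) hA hC

theorem mem_of_subsingleton [Subsingleton A] : S (ModuleCat.of R A) :=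
  S.prop_of_isZero (ModuleCat.isZero_of_subsingleton _)

/-- A module is in `S` as soon as the kernel of a map out of it and the target are. -/
theorem mem_of_ker (f : A →ₗ[R] B) (hk : S (ModuleCat.of R (LinearMap.ker f)))
    (hB : S (ModuleCat.of R B)) : S (ModuleCat.of R A) :=
  mem_of_exact S (LinearMap.ker f).subtype f (fun x => by simp) hk hB

theorem mem_ker_comp (f : A →ₗ[R] B) (g : B →ₗ[R] C)
    (hf : S (ModuleCat.of R (LinearMap.ker f))) (hg : S (ModuleCat.of R (LinearMap.ker g))) :
    S (ModuleCat.of R (LinearMap.ker (g ∘ₗ f))) := by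
  have hm : ∀ z ∈ LinearMap.ker (g ∘ₗ f), f z ∈ LinearMap.ker g := fun z hz => hz
  refine mem_of_ker S (f.restrict hm) ?_ hg
  refine mem_of_injective S (LinearMap.codRestrict (LinearMap.ker f)
    ((LinearMap.ker (g ∘ₗ f)).subtype ∘ₗ (LinearMap.ker (f.restrict hm)).subtype) ?_) ?_ hf
  · rintro ⟨⟨x, hx⟩, hx'⟩
    simpa [Subtype.ext_iff] using hx'
  · rintro ⟨⟨x, hx⟩, hx'⟩ ⟨⟨y, hy⟩, hy'⟩ h
    simpa [Subtype.ext_iff] using h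

theorem mem_ker_pow (f : A →ₗ[R] A) (hf : S (ModuleCat.of R (LinearMap.ker f))) (n : ℕ) :
    S (ModuleCat.of R (LinearMap.ker (f ^ n))) := by
  induction n with
  | zero =>
    have : Subsingleton (LinearMap.ker (f ^ 0)) := by
      rw [pow_zero, Module.End.one_eq_id, LinearMap.ker_id]; infer_instance
    exact mem_of_subsingleton S
  | succ n ih =>
    rw [pow_succ']
    exact mem_ker_comp S _ _ ih hf

theorem mem_pi (k : ℕ) (h : S (ModuleCat.of R A)) : S (ModuleCat.of R (Fin k → A)) := by
  induction k with
  | zero => exact mem_of_subsingleton S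
  | succ k ih =>
    refine mem_of_exact S (LinearMap.single R (fun _ : Fin (k + 1) => A) 0)
      (LinearMap.funLeft R A Fin.succ) ?_ h ih
    intro y
    constructor
    · intro hy
      refine ⟨y 0, ?_⟩
      ext i
      refine Fin.cases (by simp) (fun j => ?_) i
      have := congrFun hy j
      simpa [LinearMap.funLeft_apply] using this.symm
    · rintro ⟨z, rfl⟩
      ext j
      simp [LinearMap.funLeft_apply]

/-- `Hom(P, A)` is in `S` when `P` is finitely generated and `A` is in `S`. -/
theorem mem_linearMap {P : Type u} [AddCommGroup P] [Module R P] [Module.Finite R P]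
    (h : S (ModuleCat.of R A)) : S (ModuleCat.of R (P →ₗ[R] A)) := by
  obtain ⟨k, π, hπ⟩ := Module.Finite.exists_fin' R P
  refine mem_of_injective S (B := Fin k → A)
    ((LinearMap.pi fun i => LinearMap.applyₗ (π (Pi.single i 1)))) ?_ (mem_pi S k h)
  intro f g hfg
  have : f ∘ₗ π = g ∘ₗ π := by
    refine LinearMap.pi_ext' fun i => LinearMap.ext_ring ?_
    simpa using congrFun hfg i
  ext x
  obtain ⟨y, rfl⟩ := hπ x
  exact LinearMap.congr_fun this y

end Serre

/-! ### Finitely generated modules in a Serre class and prime avoidance -/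

section Avoidance

variable {R : Type u} [CommRing R] [IsNoetherianRing R]
  (S : ObjectProperty (ModuleCat.{u} R)) [S.IsSerreClass]

theorem mem_of_forall_support (N : Type u) [AddCommGroup N] [Module R N] [Module.Finite R N]
    (h : ∀ p ∈ Module.support R N, S (ModuleCat.of R (R ⧸ p.asIdeal))) :
    S (ModuleCat.of R N) := by
  induction ‹Module.Finite R N› using
      IsNoetherianRing.induction_on_isQuotientEquivQuotientPrime R with
  | subsingleton N => exact mem_of_subsingleton S
  | quotient N p e =>
    rw [mem_iff_of_equiv S e]
    refine h p ?_
    rw [e.support_eq, Module.support_of_algebra]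
    simp [PrimeSpectrum.mem_zeroLocus]
  | exact N₁ N₂ N₃ f g hf hg hfg h₁ h₃ =>
    rw [Module.support_of_exact hfg hf hg] at h
    exact mem_of_exact S f g hfg (h₁ fun p hp => h p (Or.inl hp)) (h₃ fun p hp => h p (Or.inr hp))

theorem mem_of_forall_associatedPrimes (N : Type u) [AddCommGroup N] [Module R N]
    [Module.Finite R N] (h : ∀ p ∈ associatedPrimes R N, S (ModuleCat.of R (R ⧸ p))) :
    S (ModuleCat.of R N) := by
  refine mem_of_forall_support S N fun p hp => ?_
  obtain ⟨q, hq, hqp⟩ := Ideal.exists_minimalPrimes_le (Module.annihilator_le_of_mem_support hp)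
  exact mem_of_surjective S (Submodule.factor hqp) (Submodule.factor_surjective hqp)
    (h q (Module.associatedPrimes.minimalPrimes_annihilator_subset_associatedPrimes R N hq))

/-- Prime avoidance over the finitely many associated primes `p` of `M` with `R ⧸ p ∉ S`: none of
them contains `a`, since an element of `M` with annihilator `p ⊇ a` spans a copy of `R ⧸ p` in
`(0 :_M a)`. -/
theorem exists_mem_ker_lsmul (a : Ideal R) (M : Type u) [AddCommGroup M] [Module R M]
    [Module.Finite R M]
    (h : S (ModuleCat.of R (Submodule.torsionBySet R M (a : Set R)))) :
    ∃ x ∈ a, S (ModuleCat.of R (LinearMap.ker (LinearMap.lsmul R M x))) := by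
  classical
  have hfin : {p ∈ associatedPrimes R M | ¬ S (ModuleCat.of R (R ⧸ p))}.Finite :=
    (associatedPrimes.finite R M).subset fun p hp => hp.1
  have hnot : ¬ ((a : Set R) ⊆
      ⋃ p ∈ (hfin.toFinset : Set (Ideal R)), ((id p : Ideal R) : Set R)) := by
    rw [Ideal.subset_union_prime ⊥ ⊥ (fun p hp _ _ => ?_)]
    · rintro ⟨p, hp, hap⟩
      obtain ⟨hpM, hpS⟩ := hfin.mem_toFinset.1 hp
      obtain ⟨f, hf⟩ := (isAssociatedPrime_iff_exists_injective_linearMap p M).1 hpM |>.2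
      refine hpS (mem_of_injective S (f.codRestrict _ fun c => ?_) ?_ h)
      · rw [Submodule.mem_torsionBySet_iff]
        rintro ⟨r, hr⟩
        obtain ⟨c, rfl⟩ := Ideal.Quotient.mk_surjective c
        change r • f _ = 0
        rw [← map_smul, ← map_zero f]
        congr 1
        exact Ideal.Quotient.eq_zero_iff_mem.2 (p.mul_mem_right _ (hap hr))
      · intro c d hcd
        exact hf (congrArg Subtype.val hcd)
    · exact (hfin.mem_toFinset.1 hp).1.isPrime
  obtain ⟨x, hxa, hx⟩ := Set.not_subset.1 hnot
  refine ⟨x, hxa, mem_of_forall_associatedPrimes S _ fun p hp => ?_⟩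
  by_contra hpS
  have hpM := associatedPrimes.subset_of_injective
    (f := (LinearMap.ker (LinearMap.lsmul R M x)).subtype) Subtype.val_injective hp
  refine hx (Set.mem_biUnion (x := p) (by simpa using ⟨hpM, hpS⟩) ?_)
  refine IsAssociatedPrime.annihilator_le hp (Submodule.mem_annihilator.2 ?_)
  exact fun m _ => Subtype.ext (LinearMap.mem_ker.1 m.2)

end Avoidance

/-! ### Weak sequences -/

section WeakSequences

variable {R : Type u} [CommRing R] (S : ObjectProperty (ModuleCat.{u} R))
  (M : Type u) [AddCommGroup M] [Module R M]

/-- `(N :_M r) / N` is the kernel of the multiplication by `r` on `M / N`. -/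
def colonQuotientEquiv {M : Type u} [AddCommGroup M] [Module R M] (N : Submodule R M) (r : R) :
    (colon N r ⧸ N.submoduleOf (colon N r)) ≃ₗ[R]
      LinearMap.ker (LinearMap.lsmul R (M ⧸ N) r) :=
  LinearEquiv.ofBijective
    ((N.submoduleOf (colon N r)).liftQ
      ((N.mkQ ∘ₗ (colon N r).subtype).codRestrict _ (by
        rintro ⟨m, hm⟩
        have hm' : r • m ∈ N := hm
        simpa [← Submodule.Quotient.mk_smul] using hm'))
      (by
        rintro ⟨m, hm⟩ h
        have h' : m ∈ N := h
        exact Subtype.ext ((Submodule.Quotient.mk_eq_zero N).2 h')))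
    (by
      constructor
      · rw [← LinearMap.ker_eq_bot]
        refine Submodule.ker_liftQ_eq_bot _ _ _ ?_
        rintro ⟨m, hm⟩ h
        exact (Submodule.Quotient.mk_eq_zero N).1 (congrArg Subtype.val h)
      · rintro ⟨c, hc⟩
        obtain ⟨m, rfl⟩ := N.mkQ_surjective c
        have hm : m ∈ colon N r := by
          change r • m ∈ N
          exact (Submodule.Quotient.mk_eq_zero N).1 hc
        exact ⟨Submodule.Quotient.mk ⟨m, hm⟩, rfl⟩)

theorem seqSubmodule_append_singleton (xs : List R) (x : R) :
    seqSubmodule M (xs ++ [x]) = seqSubmodule M xs ⊔ LinearMap.range (LinearMap.lsmul R M x) := by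
  rw [seqSubmodule, Ideal.ofList_append, Submodule.sup_smul, Ideal.ofList_singleton,
    Submodule.ideal_span_singleton_smul, seqSubmodule]
  congr 1
  ext m
  simp [Submodule.mem_smul_pointwise_iff_exists]

theorem isWeakSeq_nil : IsWeakSeq S M [] := fun i hi => by simp at hi

theorem isWeakSeq_append_singleton [S.IsSerreClass] (xs : List R) (x : R) :
    IsWeakSeq S M (xs ++ [x]) ↔ IsWeakSeq S M xs ∧
      S (ModuleCat.of R (LinearMap.ker (LinearMap.lsmul R (M ⧸ seqSubmodule M xs) x))) := by
  constructor
  · intro h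
    refine ⟨fun i hi => ?_, ?_⟩
    · have := h i (by simp; omega)
      rwa [List.getElem_append_left hi, List.take_append_of_le_length hi.le] at this
    · have := h xs.length (by simp)
      rw [List.getElem_concat_length rfl, List.take_left] at this
      exact (mem_iff_of_equiv S (colonQuotientEquiv _ _)).1 this
  · rintro ⟨h, hx⟩ i hi
    rcases Nat.lt_or_ge i xs.length with hlt | hge
    · have := h i hlt
      rwa [List.getElem_append_left hlt, List.take_append_of_le_length hlt.le]
    · obtain rfl : i = xs.length := by simp at hi; omega
      rw [List.getElem_concat_length rfl, List.take_left]
      exact (mem_iff_of_equiv S (colonQuotientEquiv _ _)).2 hx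

theorem seqSubmodule_le_append (xs : List R) (x : R) :
    seqSubmodule M xs ≤ seqSubmodule M (xs ++ [x]) := by
  rw [seqSubmodule_append_singleton]
  exact le_sup_left

/-- The projection `M / (xs)M → M / (xs, x)M`. -/
def seqFactor (xs : List R) (x : R) :
    (M ⧸ seqSubmodule M xs) →ₗ[R] (M ⧸ seqSubmodule M (xs ++ [x])) :=
  Submodule.factor (seqSubmodule_le_append M xs x)

theorem seqFactor_surjective (xs : List R) (x : R) : Function.Surjective (seqFactor M xs x) :=
  Submodule.factor_surjective (seqSubmodule_le_append M xs x)

theorem ker_seqFactor (xs : List R) (x : R) :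
    LinearMap.ker (seqFactor M xs x) =
      LinearMap.range (LinearMap.lsmul R (M ⧸ seqSubmodule M xs) x) := by
  ext c
  obtain ⟨m, rfl⟩ := Submodule.mkQ_surjective _ c
  have h1 : (seqSubmodule M xs).mkQ m ∈ LinearMap.ker (seqFactor M xs x) ↔
      m ∈ seqSubmodule M (xs ++ [x]) := by
    rw [LinearMap.mem_ker]
    exact Submodule.Quotient.mk_eq_zero _
  rw [h1, seqSubmodule_append_singleton, Submodule.mem_sup]
  constructor
  · rintro ⟨n, hn, _, ⟨z, rfl⟩, rfl⟩
    refine ⟨Submodule.mkQ _ z, ?_⟩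
    have : (seqSubmodule M xs).mkQ n = 0 := by simpa using hn
    simp [map_add, this]
  · rintro ⟨c, hc⟩
    obtain ⟨z, rfl⟩ := Submodule.mkQ_surjective _ c
    refine ⟨m - x • z, ?_, x • z, ⟨z, rfl⟩, by simp⟩
    have : (seqSubmodule M xs).mkQ (m - x • z) = 0 := by
      rw [map_sub, sub_eq_zero, ← hc]; rfl
    exact (Submodule.Quotient.mk_eq_zero _).1 this

end WeakSequences

/-! ### Grades of families of module properties -/

section Grade

variable {R : Type u} [CommRing R] (S : ObjectProperty (ModuleCat.{u} R)) (a : Ideal R)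

/-- A family `P i` of properties of modules that behaves like `Tⁱ(M) ∈ S` for a cohomological
functor `T` with values annihilated by powers of elements of `a`: on finitely generated modules, an
element `x ∈ a` with `(0 :_M x) ∈ S` gives `P 0 M`, and `P i (M / xM)` implies `P (i + 1) M`. -/
structure IsVanishing (P : ℕ → ModuleCat.{u} R → Prop) : Prop where
  iso (M M' : Type u) [AddCommGroup M] [Module R M] [AddCommGroup M'] [Module R M']
    (e : M ≃ₗ[R] M') (i : ℕ) (hP : P i (ModuleCat.of R M)) : P i (ModuleCat.of R M')
  zero (M : Type u) [AddCommGroup M] [Module R M] [Module.Finite R M] (x : R) (hx : x ∈ a)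
    (h : S (ModuleCat.of R (LinearMap.ker (LinearMap.lsmul R M x)))) : P 0 (ModuleCat.of R M)
  up (M M' : Type u) [AddCommGroup M] [Module R M] [Module.Finite R M] [AddCommGroup M']
    [Module R M'] (g : M →ₗ[R] M') (hg : Function.Surjective g) (x : R) (hx : x ∈ a)
    (h : S (ModuleCat.of R (LinearMap.ker (LinearMap.lsmul R M x))))
    (hker : LinearMap.ker g = LinearMap.range (LinearMap.lsmul R M x)) (i : ℕ)
    (hP : P i (ModuleCat.of R M')) : P (i + 1) (ModuleCat.of R M)

/-- A vanishing family which computes a grade: conversely `P i M` and `P (i + 1) M` imply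
`P i (M / xM)`, and `P 0 M` forces `(0 :_M a) ∈ S`. -/
structure IsGradeFamily (P : ℕ → ModuleCat.{u} R → Prop) : Prop extends
    IsVanishing S a P where
  down (M M' : Type u) [AddCommGroup M] [Module R M] [Module.Finite R M] [AddCommGroup M']
    [Module R M'] (g : M →ₗ[R] M') (hg : Function.Surjective g) (x : R) (hx : x ∈ a)
    (h : S (ModuleCat.of R (LinearMap.ker (LinearMap.lsmul R M x))))
    (hker : LinearMap.ker g = LinearMap.range (LinearMap.lsmul R M x)) (i : ℕ)
    (hP : P i (ModuleCat.of R M)) (hP' : P (i + 1) (ModuleCat.of R M)) : P i (ModuleCat.of R M')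
  socle (M : Type u) [AddCommGroup M] [Module R M] [Module.Finite R M]
    (hP : P 0 (ModuleCat.of R M)) :
    S (ModuleCat.of R (Submodule.torsionBySet R M (a : Set R)))

variable {S a} {P : ℕ → ModuleCat.{u} R → Prop}
  (M : Type u) [AddCommGroup M] [Module R M] [Module.Finite R M]

omit [Module.Finite R M] in
theorem IsVanishing.quotient_nil_iff (hP : IsVanishing S a P) (i : ℕ) :
    P i (ModuleCat.of R (M ⧸ seqSubmodule M ([] : List R))) ↔ P i (ModuleCat.of R M) :=
  have e : (M ⧸ seqSubmodule M ([] : List R)) ≃ₗ[R] M :=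
    (seqSubmodule M ([] : List R)).quotEquivOfEqBot (by simp [seqSubmodule])
  ⟨hP.iso _ _ e i, hP.iso _ _ e.symm i⟩

variable [S.IsSerreClass]

/-- Properties of `M / (xs)M` in degrees below `n` lift to `M` in degrees below `n + length xs`. -/
theorem IsVanishing.of_quotient (hP : IsVanishing S a P) (xs : List R)
    (hxa : ∀ r ∈ xs, r ∈ a) (hxs : IsWeakSeq S M xs) (n : ℕ)
    (h : ∀ i < n, P i (ModuleCat.of R (M ⧸ seqSubmodule M xs))) :
    ∀ i < n + xs.length, P i (ModuleCat.of R M) := by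
  induction xs using List.reverseRecOn generalizing n with
  | nil => exact fun i hi => (hP.quotient_nil_iff M i).1 (h i hi)
  | append_singleton xs x ih =>
    obtain ⟨hxs, hx⟩ := (isWeakSeq_append_singleton S M xs x).1 hxs
    have hxa' : x ∈ a := hxa x (by simp)
    intro i hi
    refine ih (fun r hr => hxa r (by simp [hr])) hxs (n + 1) ?_ i (by simp at hi; omega)
    rintro (_ | j) hj
    · exact hP.zero _ x hxa' hx
    · exact hP.up _ _ (seqFactor M xs x) (seqFactor_surjective M xs x) x hxa' hx
        (ker_seqFactor M xs x) j (h j (by omega))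

theorem IsVanishing.of_isWeakSeq (hP : IsVanishing S a P) (xs : List R)
    (hxa : ∀ r ∈ xs, r ∈ a) (hxs : IsWeakSeq S M xs) :
    ∀ i < xs.length, P i (ModuleCat.of R M) := fun i hi =>
  hP.of_quotient M xs hxa hxs 0 (by simp) i (by omega)

/-- Converse of `IsVanishing.of_quotient`. -/
theorem IsGradeFamily.quotient (hP : IsGradeFamily S a P) (xs : List R)
    (hxa : ∀ r ∈ xs, r ∈ a) (hxs : IsWeakSeq S M xs) (n : ℕ)
    (h : ∀ i < n + xs.length, P i (ModuleCat.of R M)) :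
    ∀ i < n, P i (ModuleCat.of R (M ⧸ seqSubmodule M xs)) := by
  induction xs using List.reverseRecOn generalizing n with
  | nil => exact fun i hi => (hP.quotient_nil_iff M i).2 (h i hi)
  | append_singleton xs x ih =>
    obtain ⟨hxs, hx⟩ := (isWeakSeq_append_singleton S M xs x).1 hxs
    have ih := ih (fun r hr => hxa r (by simp [hr])) hxs (n + 1)
      fun i hi => h i (by simp; omega)
    exact fun i hi => hP.down _ _ (seqFactor M xs x) (seqFactor_surjective M xs x) x
      (hxa x (by simp)) hx (ker_seqFactor M xs x) i (ih i (by omega)) (ih (i + 1) (by omega))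

variable [IsNoetherianRing R]

/-- A weak sequence shorter than the grade can be extended. -/
theorem IsGradeFamily.exists_append (hP : IsGradeFamily S a P) (xs : List R)
    (hxa : ∀ r ∈ xs, r ∈ a) (hxs : IsWeakSeq S M xs)
    (h : ∀ i < xs.length + 1, P i (ModuleCat.of R M)) :
    ∃ x ∈ a, IsWeakSeq S M (xs ++ [x]) := by
  have h0 := hP.quotient M xs hxa hxs 1 (fun i hi => h i (by omega)) 0 one_pos
  obtain ⟨x, hx, hxS⟩ := exists_mem_ker_lsmul S a _ (hP.socle _ h0)
  exact ⟨x, hx, (isWeakSeq_append_singleton S M xs x).2 ⟨hxs, hxS⟩⟩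

theorem IsGradeFamily.exists_isWeakSeq (hP : IsGradeFamily S a P) (n : ℕ)
    (h : ∀ i < n, P i (ModuleCat.of R M)) :
    ∃ xs : List R, xs.length = n ∧ (∀ r ∈ xs, r ∈ a) ∧ IsWeakSeq S M xs := by
  induction n with
  | zero => exact ⟨[], rfl, by simp, isWeakSeq_nil S M⟩
  | succ n ih =>
    obtain ⟨xs, rfl, hxa, hxs⟩ := ih fun i hi => h i (by omega)
    obtain ⟨x, hx, hxS⟩ := hP.exists_append M xs hxa hxs h
    exact ⟨xs ++ [x], by simp, by simpa [or_imp, forall_and] using ⟨hxa, hx⟩, hxS⟩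

theorem IsGradeFamily.cGrade_eq (hP : IsGradeFamily S a P) :
    cGrade S a M = sInf {e : ℕ∞ | ∃ i : ℕ, e = i ∧ ¬ P i (ModuleCat.of R M)} := by
  apply le_antisymm
  · refine sSup_le ?_
    rintro _ ⟨xs, hxa, hxs, rfl⟩
    refine le_sInf ?_
    rintro _ ⟨i, rfl, hi⟩
    by_contra hlt
    exact hi (hP.of_isWeakSeq M xs hxa hxs i (by simpa using hlt))
  · refine ENat.forall_natCast_le_iff_le.1 fun n hn => ?_
    obtain ⟨xs, rfl, hxa, hxs⟩ := hP.exists_isWeakSeq M n fun i hi => by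
      by_contra hPi
      have := hn.trans (sInf_le ⟨i, rfl, hPi⟩)
      exact absurd hi (by simpa using this)
    exact le_sSup ⟨xs, hxa, hxs, rfl⟩

theorem IsGradeFamily.length_eq_of_isMaximalIn (hP : IsGradeFamily S a P) (xs : List R)
    (h : IsMaximalIn a (IsWeakSeq S M) xs) :
    (xs.length : ℕ∞) = sInf {e : ℕ∞ | ∃ i : ℕ, e = i ∧ ¬ P i (ModuleCat.of R M)} := by
  obtain ⟨hxa, hxs, hmax⟩ := h
  have hlt := hP.of_isWeakSeq M xs hxa hxs
  apply le_antisymm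
  · refine le_sInf ?_
    rintro _ ⟨i, rfl, hi⟩
    by_contra hc
    exact hi (hlt i (by simpa using hc))
  · refine sInf_le ⟨_, rfl, fun hlast => ?_⟩
    obtain ⟨x, hx, hxS⟩ := hP.exists_append M xs hxa hxs fun i hi => by
      rcases Nat.lt_succ_iff_lt_or_eq.1 hi with hi | rfl
      exacts [hlt i hi, hlast]
    have := hmax (xs ++ [x]) (by simpa [or_imp, forall_and] using ⟨hxa, hx⟩) hxS
      (List.prefix_append _ _)
    simp at this

end Grade

/-! ### Cohomological functors and their grades -/

section Cohomological

variable {R : Type u} [CommRing R]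

theorem moduleCat_shortExact {A B C : Type u} [AddCommGroup A] [Module R A] [AddCommGroup B]
    [Module R B] [AddCommGroup C] [Module R C] (f : A →ₗ[R] B) (g : B →ₗ[R] C)
    (hf : Function.Injective f) (hg : Function.Surjective g) (h : Function.Exact f g) :
    (ShortComplex.mk (ModuleCat.ofHom f) (ModuleCat.ofHom g)
      (by ext x; exact h.apply_apply_eq_zero x)).ShortExact where
  exact := (ShortComplex.ShortExact.moduleCat_exact_iff_function_exact _).2 h
  mono_f := (ModuleCat.mono_iff_injective _).2 hf
  epi_g := (ModuleCat.epi_iff_surjective _).2 hg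

/-- A sequence of functors on modules with a (not necessarily natural) long exact sequence starting
in degree zero, each of which takes multiplication by `x` to multiplication by `x`. -/
structure IsCohomological (T : ℕ → ModuleCat.{u} R ⥤ ModuleCat.{u} R) : Prop where
  map_smul (i : ℕ) (M : ModuleCat.{u} R) (x : R) : (T i).map (x • 𝟙 M) = x • 𝟙 ((T i).obj M)
  injective (X : ShortComplex (ModuleCat.{u} R)) (hX : X.ShortExact) :
    Function.Injective ((T 0).map X.f).hom
  exact (X : ShortComplex (ModuleCat.{u} R)) (hX : X.ShortExact) (i : ℕ) :
    Function.Exact ((T i).map X.f).hom ((T i).map X.g).hom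
  exists_δ (X : ShortComplex (ModuleCat.{u} R)) (hX : X.ShortExact) (i : ℕ) :
    ∃ δ : (T i).obj X.X₃ →ₗ[R] (T (i + 1)).obj X.X₁,
      Function.Exact ((T i).map X.g).hom δ ∧ Function.Exact δ ((T (i + 1)).map X.f).hom

variable {S : ObjectProperty (ModuleCat.{u} R)} [S.IsSerreClass] {a : Ideal R}

/-- The kernel of the second map of an exact pair is in `S` with the source of the first. -/
theorem mem_ker_of_exact {A B C : Type u} [AddCommGroup A] [Module R A] [AddCommGroup B]
    [Module R B] [AddCommGroup C] [Module R C] (f : A →ₗ[R] B) (g : B →ₗ[R] C)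
    (h : Function.Exact f g) (hA : S (ModuleCat.of R A)) :
    S (ModuleCat.of R (LinearMap.ker g)) :=
  mem_of_surjective S (f.codRestrict (LinearMap.ker g) h.apply_apply_eq_zero)
    (fun ⟨b, hb⟩ => by
      obtain ⟨c, hc⟩ := (h b).1 hb
      exact ⟨c, Subtype.ext hc⟩) hA

variable {T : ℕ → ModuleCat.{u} R ⥤ ModuleCat.{u} R}

section

variable (M : Type u) [AddCommGroup M] [Module R M] (x : R)

theorem shortExact_ker_range :
    (ShortComplex.mk (ModuleCat.ofHom (LinearMap.ker (LinearMap.lsmul R M x)).subtype)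
      (ModuleCat.ofHom (LinearMap.lsmul R M x).rangeRestrict)
      (by ext m; exact m.2)).ShortExact :=
  moduleCat_shortExact _ _ Subtype.val_injective (LinearMap.surjective_rangeRestrict _)
    (fun m => by simp [Subtype.ext_iff])

variable {M x} in
theorem shortExact_range {M' : Type u} [AddCommGroup M'] [Module R M'] {g : M →ₗ[R] M'}
    (hg : Function.Surjective g)
    (hker : LinearMap.ker g = LinearMap.range (LinearMap.lsmul R M x)) :
    (ShortComplex.mk (ModuleCat.ofHom (LinearMap.range (LinearMap.lsmul R M x)).subtype)
      (ModuleCat.ofHom g)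
      (by ext m; exact LinearMap.mem_ker.1 (hker.ge m.2))).ShortExact :=
  moduleCat_shortExact _ _ Subtype.val_injective hg
    (fun m => by rw [← LinearMap.mem_ker, hker]; simp)

/-- Multiplication by `x` on `Tⁱ(M)` factors through `Tⁱ(xM)`. If `Tⁱ` of the kernel of
`M → xM` and the kernel of `Tⁱ(xM) → Tⁱ(M)` are in `S`, so are the kernels of the powers of `x` on
`Tⁱ(M)`, and one of these is everything. -/
theorem IsCohomological.mem_of_factor (hT : IsCohomological T) (i m : ℕ)
    (hm : ∀ t : (T i).obj (ModuleCat.of R M), x ^ m • t = 0)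
    (hK : S ((T i).obj (ModuleCat.of R (LinearMap.ker (LinearMap.lsmul R M x)))))
    (hN : S (ModuleCat.of R (LinearMap.ker ((T i).map
      (ModuleCat.ofHom (LinearMap.range (LinearMap.lsmul R M x)).subtype)).hom))) :
    S ((T i).obj (ModuleCat.of R M)) := by
  have hq := mem_ker_of_exact _ _ (hT.exact _ (shortExact_ker_range M x) i) hK
  have hker := mem_ker_pow S _ (mem_ker_comp S _ _ hq hN) m
  have hfac : ((T i).map
      (ModuleCat.ofHom (LinearMap.range (LinearMap.lsmul R M x)).subtype)).hom ∘ₗ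
      ((T i).map (ModuleCat.ofHom (LinearMap.lsmul R M x).rangeRestrict)).hom =
      x • LinearMap.id := by
    have h := hT.map_smul i (ModuleCat.of R M) x
    rw [← ModuleCat.hom_comp, ← Functor.map_comp]
    exact congrArg ModuleCat.Hom.hom h
  have htop : LinearMap.ker ((x • LinearMap.id : Module.End R ((T i).obj (ModuleCat.of R M))) ^ m)
      = ⊤ := by
    rw [LinearMap.ker_eq_top, ← Module.End.one_eq_id, smul_pow, one_pow]
    ext t
    exact hm t
  dsimp only at hker
  rw [hfac, htop] at hker
  exact (mem_iff_of_equiv S Submodule.topEquiv).1 hker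

end

variable [IsNoetherianRing R]

/-- A cohomological functor preserving membership in `S` of finitely generated modules, and whose
values are annihilated by bounded powers of the elements of `a`. -/
theorem IsCohomological.isVanishing (hT : IsCohomological T) (m : ℕ)
    (hS : ∀ (i : ℕ) (N : Type u) [AddCommGroup N] [Module R N] [Module.Finite R N],
      S (ModuleCat.of R N) → S ((T i).obj (ModuleCat.of R N)))
    (hm : ∀ x ∈ a, ∀ (i : ℕ) (M : ModuleCat.{u} R) (t : (T i).obj M), x ^ m • t = 0) :
    IsVanishing S a (fun i M => S ((T i).obj M)) where
  iso M M' _ _ _ _ e i hP := S.prop_of_iso ((T i).mapIso e.toModuleIso) hP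
  zero M _ _ _ x hx h := by
    refine hT.mem_of_factor M x 0 m (hm x hx 0 _) (hS 0 _ h) ?_
    have := LinearMap.ker_eq_bot.2 (hT.injective _
      (shortExact_range (Submodule.mkQ_surjective _)
        (Submodule.ker_mkQ (LinearMap.range (LinearMap.lsmul R M x)))))
    dsimp only at this
    rw [this]
    exact mem_of_subsingleton S
  up M M' _ _ _ _ _ g hg x hx h hker i hP := by
    refine hT.mem_of_factor M x (i + 1) m (hm x hx (i + 1) _) (hS (i + 1) _ h) ?_
    obtain ⟨δ, -, hδ⟩ := hT.exists_δ _ (shortExact_range hg hker) i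
    exact mem_ker_of_exact _ _ hδ hP

theorem IsCohomological.isGradeFamily (hT : IsCohomological T) (m : ℕ)
    (hS : ∀ (i : ℕ) (N : Type u) [AddCommGroup N] [Module R N] [Module.Finite R N],
      S (ModuleCat.of R N) → S ((T i).obj (ModuleCat.of R N)))
    (hm : ∀ x ∈ a, ∀ (i : ℕ) (M : ModuleCat.{u} R) (t : (T i).obj M), x ^ m • t = 0)
    (socle : ∀ (M : Type u) [AddCommGroup M] [Module R M],
      ∃ f : Submodule.torsionBySet R M (a : Set R) →ₗ[R] (T 0).obj (ModuleCat.of R M),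
        Function.Injective f) :
    IsGradeFamily S a (fun i M => S ((T i).obj M)) where
  toIsVanishing := hT.isVanishing m hS hm
  down M M' _ _ _ _ _ g hg x hx h hker i hP hP' := by
    obtain ⟨δ, hδ, -⟩ := hT.exists_δ _ (shortExact_range hg hker) i
    obtain ⟨ε, hε, -⟩ := hT.exists_δ _ (shortExact_ker_range M x) (i + 1)
    refine mem_of_exact S _ δ hδ hP (mem_of_exact S _ ε hε hP' (hS (i + 2) _ h))
  socle M _ _ _ hP := by
    obtain ⟨f, hf⟩ := socle M
    exact mem_of_injective S f hf hP

end Cohomological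

/-! ### The Ext functors -/

section Ext

open Abelian

variable {R : Type u} [CommRing R]

/-- The functor `M ↦ Extⁱ(N, M)`. -/
@[simps]
def extFunctor (N : Type u) [AddCommGroup N] [Module R N] (i : ℕ) :
    ModuleCat.{u} R ⥤ ModuleCat.{u} R where
  obj M := ModuleCat.of R (Ext (ModuleCat.of R N) M i)
  map f := ModuleCat.ofHom ((Ext.mk₀ f).postcompOfLinear R _ (add_zero i))
  map_id M := by ext x; simp
  map_comp f g := by ext x; simp

theorem isCohomological_ext (N : Type u) [AddCommGroup N] [Module R N] :
    IsCohomological (extFunctor (R := R) N) where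
  map_smul i M x := by
    ext y
    exact (Ext.smul_eq_comp_mk₀ y x).symm
  injective X hX := by
    have := hX.mono_f
    exact Ext.postcomp_mk₀_injective_of_mono _ X.f
  exact X hX i y := by
    constructor
    · exact Ext.covariant_sequence_exact₂ _ hX y
    · rintro ⟨(y : Ext (ModuleCat.of R N) X.X₁ i), rfl⟩
      change (y.comp (Ext.mk₀ X.f) (add_zero i)).comp (Ext.mk₀ X.g) (add_zero i) = 0
      simp
  exists_δ X hX i := by
    refine ⟨hX.extClass.postcompOfLinear R _ rfl, fun y => ⟨?_, ?_⟩, fun y => ⟨?_, ?_⟩⟩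
    · exact Ext.covariant_sequence_exact₃ _ hX y rfl
    · rintro ⟨(y : Ext (ModuleCat.of R N) X.X₂ i), rfl⟩
      change (y.comp (Ext.mk₀ X.g) (add_zero i)).comp hX.extClass rfl = 0
      simp [Ext.comp_assoc_of_second_deg_zero]
    · exact fun h => Ext.covariant_sequence_exact₁ _ hX y h rfl
    · rintro ⟨(y : Ext (ModuleCat.of R N) X.X₃ i), rfl⟩
      change (y.comp hX.extClass rfl).comp (Ext.mk₀ X.f) (add_zero (i + 1)) = 0
      simp [Ext.comp_assoc_of_third_deg_zero]

theorem ext_smul_eq_zero {N M : ModuleCat.{u} R} (x : R) (hx : ∀ n : N, x • n = 0) (i : ℕ)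
    (y : Ext N M i) : x • y = 0 := by
  have h : x • 𝟙 N = 0 := by ext n; exact hx n
  rw [← Ext.mk₀_id_comp y, ← Ext.smul_comp, ← Ext.mk₀_smul, h, Ext.mk₀_zero, Ext.zero_comp]

variable [IsNoetherianRing R] (S : ObjectProperty (ModuleCat.{u} R)) [S.IsSerreClass]

/-- By dimension shifting in the first variable, along presentations by finite free modules. -/
theorem mem_ext_of_mem (N : Type u) [AddCommGroup N] [Module R N] [Module.Finite R N]
    (A : ModuleCat.{u} R) (hA : S A) (i : ℕ) :
    S (ModuleCat.of R (Ext (ModuleCat.of R N) A i)) := by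
  induction i generalizing N with
  | zero =>
    have h := mem_linearMap S (A := A) (P := N) hA
    refine mem_of_injective S ((ModuleCat.homLinearEquiv (S := R)).toLinearMap ∘ₗ
      (Ext.linearEquiv₀ (R := R)).toLinearMap)
      ((ModuleCat.homLinearEquiv (S := R)).injective.comp (Ext.linearEquiv₀ (R := R)).injective) h
  | succ i ih =>
    obtain ⟨k, π, hπ⟩ := Module.Finite.exists_fin' R N
    have hX := moduleCat_shortExact (LinearMap.ker π).subtype π Subtype.val_injective hπ
      (fun x => by simp)
    refine mem_of_surjective S (hX.extClass.precompOfLinear R A (add_comm 1 i)) (fun y => ?_)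
      (ih (LinearMap.ker π))
    refine Ext.contravariant_sequence_exact₃ hX _ y ?_ (add_comm 1 i)
    have : Projective (ModuleCat.of R (Fin k → R)) :=
      ModuleCat.projective_of_free (Pi.basisFun R (Fin k))
    exact Ext.eq_zero_of_projective _

variable {S} {a : Ideal R}

/-- By `IsVanishing.of_isWeakSeq`, it follows that `Extⁱ(N, M) ∈ S` for `i` below the length of a weak
`M`-sequence in `a`. -/
theorem isVanishing_ext (N : Type u) [AddCommGroup N] [Module R N] [Module.Finite R N] (m : ℕ)
    (hN : ∀ x ∈ a, ∀ n : N, x ^ m • n = 0) :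
    IsVanishing S a (fun i M => S (ModuleCat.of R (Ext (ModuleCat.of R N) M i))) :=
  (isCohomological_ext N).isVanishing m (fun i _ _ _ _ hA => mem_ext_of_mem S N _ hA i)
    (fun x hx i _ y => ext_smul_eq_zero (x ^ m) (hN x hx) i y)

/-- `(0 :_M a)` is `Hom(R ⧸ a, M)`, and `a` annihilates `Ext(R ⧸ a, M)`. -/
theorem isGradeFamily_ext :
    IsGradeFamily S a (fun i M => S (ModuleCat.of R (Ext (ModuleCat.of R (R ⧸ a)) M i))) := by
  have ha : ∀ x ∈ a, ∀ n : R ⧸ a, x ^ 1 • n = 0 := fun x hx n => by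
    obtain ⟨r, rfl⟩ := Ideal.Quotient.mk_surjective n
    rw [pow_one]
    exact Ideal.Quotient.eq_zero_iff_mem.2 (a.mul_mem_right r hx)
  refine (isCohomological_ext (R ⧸ a)).isGradeFamily 1
    (fun i _ _ _ _ hA => mem_ext_of_mem S _ _ hA i)
    (fun x hx i _ y => ext_smul_eq_zero (x ^ 1) (ha x hx) i y) fun M _ _ => ?_
  -- `(0 :_M a) → Hom(R ⧸ a, M)`
  let φ : Submodule.torsionBySet R M (a : Set R) →ₗ[R] ((R ⧸ a) →ₗ[R] M) :=
    { toFun := fun m => a.liftQ (LinearMap.toSpanSingleton R M m) fun r hr => by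
        simpa using (Submodule.mem_torsionBySet_iff (a : Set R) (m : M)).1 m.2 ⟨r, hr⟩
      map_add' := fun m n => LinearMap.ext fun c => by
        obtain ⟨s, rfl⟩ := Ideal.Quotient.mk_surjective c
        exact smul_add s (m : M) n
      map_smul' := fun r m => LinearMap.ext fun c => by
        obtain ⟨s, rfl⟩ := Ideal.Quotient.mk_surjective c
        exact smul_comm s r (m : M) }
  let e := (Ext.linearEquiv₀ (R := R) (X := ModuleCat.of R (R ⧸ a)) (Y := ModuleCat.of R M)).trans
    (ModuleCat.homLinearEquiv (S := R))
  refine ⟨e.symm.toLinearMap ∘ₗ φ, fun m n h => ?_⟩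
  have h1 := LinearMap.congr_fun (e.symm.injective h) (Ideal.Quotient.mk a 1)
  have h2 : (1 : R) • (m : M) = (1 : R) • (n : M) := h1
  exact Subtype.ext (by simpa using h2)

end Ext

/-! ### Homology of cochain complexes of modules -/

section Cochain

variable {R : Type u} [CommRing R] (K : CochainComplex (ModuleCat.{u} R) ℕ)

theorem homology_smul_eq_zero (i : ℕ) (x : R)
    (h : ∀ φ : K.X i, (K.d i (i + 1)).hom φ = 0 → ∃ (j : ℕ) (ψ : K.X j), (K.d j i).hom ψ = x • φ)
    (t : K.homology i) : x • t = 0 := by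
  obtain ⟨z, rfl⟩ := (ModuleCat.epi_iff_surjective (K.homologyπ i)).1 inferInstance t
  obtain ⟨j, ψ, hψ⟩ := h ((K.iCycles i).hom z)
    (LinearMap.congr_fun (congrArg ModuleCat.Hom.hom (K.iCycles_d i (i + 1))) z)
  have hz : (K.toCycles j i).hom ψ = x • z := by
    apply (ModuleCat.mono_iff_injective (K.iCycles i)).1 inferInstance
    rw [map_smul]
    exact (LinearMap.congr_fun (congrArg ModuleCat.Hom.hom (K.toCycles_i j i)) ψ).trans hψ
  rw [← map_smul, ← hz]
  exact LinearMap.congr_fun (congrArg ModuleCat.Hom.hom (K.toCycles_comp_homologyπ j i)) ψ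

theorem exists_cycles_eq (i : ℕ) (φ : K.X i)
    (hφ : (K.d i (i + 1)).hom φ = 0) : ∃ z, (K.iCycles i).hom z = φ := by
  let l := K.liftCycles (ModuleCat.ofHom (LinearMap.toSpanSingleton R (K.X i) φ)) (i + 1)
    (by simp) (by ext; simpa using hφ)
  refine ⟨l.hom (1 : R), ?_⟩
  exact (LinearMap.congr_fun (congrArg ModuleCat.Hom.hom (K.liftCycles_i
    (ModuleCat.ofHom (LinearMap.toSpanSingleton R (K.X i) φ)) (i + 1) (by simp)
    (by ext; simpa using hφ))) (1 : R)).trans (one_smul R φ)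

theorem mem_homology (S : ObjectProperty (ModuleCat.{u} R)) [S.IsSerreClass] (i : ℕ)
    (h : S (K.X i)) : S (K.homology i) :=
  S.prop_of_epi (K.homologyπ i) (S.prop_of_mono (K.iCycles i) h)

theorem exists_injective_homology_zero {A : Type u} [AddCommGroup A] [Module R A]
    (f : A →ₗ[R] K.X 0) (hf : Function.Injective f) (h : (K.d 0 1).hom ∘ₗ f = 0) :
    ∃ g : A →ₗ[R] K.homology 0, Function.Injective g := by
  have hl : ModuleCat.ofHom f ≫ K.d 0 1 = 0 := by ext x; exact LinearMap.congr_fun h x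
  let l := K.liftCycles (ModuleCat.ofHom f) 1 (by simp) hl
  have hπ : IsIso (K.homologyπ 0) := K.isIso_homologyπ 0 0 (by simp) (by simp)
  have hli : l ≫ K.iCycles 0 = ModuleCat.ofHom f := K.liftCycles_i _ _ _ _
  have hmono : Mono (l ≫ K.iCycles 0) := hli ▸ (ModuleCat.mono_iff_injective _).2 hf
  have : Mono l := mono_of_mono l (K.iCycles 0)
  exact ⟨(l ≫ K.homologyπ 0).hom, (ModuleCat.mono_iff_injective _).1 inferInstance⟩

theorem mem_of_homology (S : ObjectProperty (ModuleCat.{u} R)) [S.IsSerreClass] (i : ℕ)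
    (h : S (K.homology i)) {A : Type u} [AddCommGroup A] [Module R A] (g : K.X i →ₗ[R] A)
    (hg : ∀ (j : ℕ) (ψ : K.X j), g ((K.d j i).hom ψ) = 0)
    (hsurj : ∀ y : A, ∃ φ : K.X i, (K.d i (i + 1)).hom φ = 0 ∧ g φ = y) :
    S (ModuleCat.of R A) := by
  let p := K.descOpcycles (ModuleCat.ofHom g) _ rfl (by ext ψ; exact hg _ ψ)
  refine mem_of_surjective S (K.homologyι i ≫ p).hom (fun y => ?_) h
  obtain ⟨φ, hφ, rfl⟩ := hsurj y
  obtain ⟨z, rfl⟩ := exists_cycles_eq K i φ hφ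
  refine ⟨(K.homologyπ i).hom z, ?_⟩
  have e : K.homologyπ i ≫ K.homologyι i ≫ p = K.iCycles i ≫ ModuleCat.ofHom g := by
    rw [K.homology_π_ι_assoc, K.p_descOpcycles]
  exact LinearMap.congr_fun (congrArg ModuleCat.Hom.hom e) z

end Cochain

/-! ### Cohomology of `Hom(C, M)` for a complex `C` of projectives -/

section HomComplex

variable {R : Type u} [CommRing R] (C : ChainComplex (ModuleCat.{u} R) ℕ)

/-- The functor `M ↦ Hom(C, M)` to cochain complexes. -/
def homCochain : ModuleCat.{u} R ⥤ CochainComplex (ModuleCat.{u} R) ℕ where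
  obj M := C.linearYonedaObj R M
  map {M N} f :=
    { f := fun i => ModuleCat.ofHom (Linear.rightComp R (C.X i) f)
      comm' := fun i j _ => by
        ext φ
        exact (Category.assoc (C.d j i) φ f).symm }
  map_id M := by
    ext i φ
    exact Category.comp_id φ
  map_comp f g := by
    ext i φ
    exact (Category.assoc φ f g).symm

/-- The functor `M ↦ Hⁱ(Hom(C, M))`. -/
def homCohomology (i : ℕ) : ModuleCat.{u} R ⥤ ModuleCat.{u} R :=
  homCochain C ⋙ HomologicalComplex.homologyFunctor _ _ i

variable {C}

theorem comp_f_comp_g (X : ShortComplex (ModuleCat.{u} R)) {Y : ModuleCat.{u} R} (φ : Y ⟶ X.X₁) :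
    (φ ≫ X.f) ≫ X.g = 0 := by
  simp

theorem shortExact_homCochain (hC : ∀ i, Projective (C.X i)) (X : ShortComplex (ModuleCat.{u} R))
    (hX : X.ShortExact) :
    (ShortComplex.mk ((homCochain C).map X.f) ((homCochain C).map X.g) (by
      ext i φ
      exact comp_f_comp_g X (Y := C.X i) φ)).ShortExact := by
  have := hX.mono_f
  have := hX.epi_g
  refine HomologicalComplex.shortExact_of_degreewise_shortExact _ fun i => ?_
  refine moduleCat_shortExact (Linear.rightComp R (C.X i) X.f) (Linear.rightComp R (C.X i) X.g)
    (fun φ ψ h => (cancel_mono X.f).1 h) (fun φ => ?_) (fun φ => ⟨fun h => ?_, ?_⟩)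
  · exact ⟨Projective.factorThru φ X.g, Projective.factorThru_comp φ X.g⟩
  · exact ⟨hX.exact.lift φ h, hX.exact.lift_f φ h⟩
  · rintro ⟨ψ, rfl⟩
    exact comp_f_comp_g X (Y := C.X i) ψ

theorem isCohomological_homCohomology (hC : ∀ i, Projective (C.X i)) :
    IsCohomological (homCohomology C) where
  map_smul i M x := by
    have h : (homCochain C).map (x • 𝟙 M) = x • 𝟙 ((homCochain C).obj M) := by
      ext j φ
      exact (Linear.comp_smul (C.X j) M M φ x (𝟙 M)).trans (congrArg (x • ·) (Category.comp_id φ))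
    change HomologicalComplex.homologyMap ((homCochain C).map (x • 𝟙 M)) i = _
    rw [h]
    refine (ShortComplex.homologyMap_smul
      ((HomologicalComplex.shortComplexFunctor _ _ i).map (𝟙 ((homCochain C).obj M))) x).trans ?_
    exact congrArg (x • ·) (HomologicalComplex.homologyMap_id _ i)
  injective X hX := by
    have : Mono ((homCochain C).map X.f) := (shortExact_homCochain hC X hX).mono_f
    -- in degree zero, homology is cycles
    have h1 : IsIso (((homCochain C).obj X.X₁).homologyπ 0) :=
      HomologicalComplex.isIso_homologyπ _ 0 0 (by simp) (by simp)
    have h2 : IsIso (((homCochain C).obj X.X₂).homologyπ 0) :=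
      HomologicalComplex.isIso_homologyπ _ 0 0 (by simp) (by simp)
    have h : HomologicalComplex.homologyMap ((homCochain C).map X.f) 0 =
        inv (((homCochain C).obj X.X₁).homologyπ 0) ≫
          HomologicalComplex.cyclesMap ((homCochain C).map X.f) 0 ≫
            ((homCochain C).obj X.X₂).homologyπ 0 := by
      rw [IsIso.eq_inv_comp, HomologicalComplex.homologyπ_naturality]
    have hm : Mono (HomologicalComplex.homologyMap ((homCochain C).map X.f) 0) := by
      rw [h]; infer_instance
    exact (ModuleCat.mono_iff_injective _).1 hm
  exact X hX i :=
    (ShortComplex.ShortExact.moduleCat_exact_iff_function_exact _).1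
      ((shortExact_homCochain hC X hX).homology_exact₂ i)
  exists_δ X hX i :=
    ⟨((shortExact_homCochain hC X hX).δ i (i + 1) rfl).hom,
      (ShortComplex.ShortExact.moduleCat_exact_iff_function_exact _).1
        ((shortExact_homCochain hC X hX).homology_exact₃ i (i + 1) rfl),
      (ShortComplex.ShortExact.moduleCat_exact_iff_function_exact _).1
        ((shortExact_homCochain hC X hX).homology_exact₁ i (i + 1) rfl)⟩

end HomComplex

/-! ### Koszul cohomology -/

section Koszul

variable {R : Type u} [CommRing R] {E M : Type u} [AddCommGroup E] [Module R E]
  [AddCommGroup M] [Module R M]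

/-- The contraction `v₁ ∧ ⋯ ∧ vⱼ ↦ ψ(e ∧ v₁ ∧ ⋯ ∧ vⱼ)` of a Koszul cochain `ψ` by a vector `e`. -/
def koszulContract {j : ℕ} (e : E) (ψ : (⋀[R]^(j + 1) E) →ₗ[R] M) : (⋀[R]^j E) →ₗ[R] M :=
  exteriorPower.alternatingMapLinearEquiv
    ((ψ.compAlternatingMap (exteriorPower.ιMulti R (j + 1))).curryLeft e)

/-- Contraction by `e` is a homotopy from multiplication by `f e` to zero; here on cocycles. -/
theorem koszulContract_comp_koszulD (f : E →ₗ[R] R) {j : ℕ} (e : E)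
    (ψ : (⋀[R]^(j + 1) E) →ₗ[R] M) (hψ : ψ ∘ₗ koszulD f (j + 1) = 0) :
    koszulContract e ψ ∘ₗ koszulD f j = f e • ψ := by
  apply exteriorPower.linearMap_ext
  ext v
  have h := LinearMap.congr_fun hψ (exteriorPower.ιMulti R (j + 2) (Matrix.vecCons e v))
  rw [LinearMap.comp_apply, koszulD_ιMulti, map_sum, Fin.sum_univ_succ] at h
  have h' : ∀ k : Fin (j + 1), (k.succ.removeNth (Matrix.vecCons e v) : Fin (j + 1) → E) =
      Matrix.vecCons e (k.removeNth v) := fun k => by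
    ext l
    refine Fin.cases ?_ (fun l => ?_) l <;> simp [Fin.removeNth, Matrix.vecCons]
  simp only [h'] at h
  simp only [LinearMap.compAlternatingMap_apply, LinearMap.comp_apply, koszulD_ιMulti, map_sum,
    map_zsmul, map_smul, LinearMap.smul_apply, koszulContract,
    exteriorPower.alternatingMapLinearEquiv_apply_ιMulti, AlternatingMap.curryLeft_apply_apply]
  simp [pow_succ, Fin.removeNth_zero] at h
  exact (add_neg_eq_zero.1 h).symm

theorem smul_eq_zero_of_comp_koszulD_zero (f : E →ₗ[R] R) (e : E)
    (ψ : (⋀[R]^0 E) →ₗ[R] M) (hψ : ψ ∘ₗ koszulD f 0 = 0) : f e • ψ = 0 := by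
  apply exteriorPower.linearMap_ext
  ext v
  have h := LinearMap.congr_fun hψ (exteriorPower.ιMulti R 1 fun _ => e)
  rw [LinearMap.comp_apply, koszulD_ιMulti] at h
  simpa [Subsingleton.elim v _] using! h

variable {n : ℕ} (y : Fin n → R)

theorem koszulComplex_d (i : ℕ) : (koszulComplex y).d (i + 1) i =
    ModuleCat.ofHom (koszulD (Fintype.linearCombination R y) i) :=
  ChainComplex.of_d (fun i => ModuleCat.of R (⋀[R]^i (Fin n → R)))
    (fun i => ModuleCat.ofHom (koszulD (Fintype.linearCombination R y) i)) i

theorem koszulCochain_d (i : ℕ) (φ : (⋀[R]^i (Fin n → R)) →ₗ[R] M) :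
    ((koszulCochain y M).d i (i + 1)).hom (ModuleCat.ofHom φ) =
      ModuleCat.ofHom (φ ∘ₗ koszulD (Fintype.linearCombination R y) i) := by
  change (koszulComplex y).d (i + 1) i ≫ ModuleCat.ofHom φ = _
  rw [koszulComplex_d]
  rfl

theorem koszulCochain_d_eq_zero_iff (i : ℕ) (φ : (⋀[R]^i (Fin n → R)) →ₗ[R] M) :
    ((koszulCochain y M).d i (i + 1)).hom (ModuleCat.ofHom φ) = 0 ↔
      φ ∘ₗ koszulD (Fintype.linearCombination R y) i = 0 := by
  rw [koszulCochain_d]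
  exact ⟨fun h => congrArg ModuleCat.Hom.hom h, fun h => by rw [h]; rfl⟩

variable {y} {a : Ideal R}

theorem exists_linearCombination_eq (hy : Ideal.span (Set.range y) = a) {x : R} (hx : x ∈ a) :
    ∃ e, Fintype.linearCombination R y e = x := by
  rw [← hy] at hx
  exact (Fintype.range_linearCombination R y).ge hx

theorem koszul_smul_eq_zero (hy : Ideal.span (Set.range y) = a) {x : R} (hx : x ∈ a) (i : ℕ)
    (t : (koszulCochain y M).homology i) : x • t = 0 := by
  obtain ⟨e, rfl⟩ := exists_linearCombination_eq hy hx
  refine homology_smul_eq_zero _ i _ (fun φ hφ => ?_) t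
  have hφ' := (koszulCochain_d_eq_zero_iff y i (ModuleCat.Hom.hom φ)).1 hφ
  cases i with
  | zero =>
    refine ⟨0, 0, ?_⟩
    rw [map_zero]
    exact (congrArg ModuleCat.ofHom (smul_eq_zero_of_comp_koszulD_zero _ e _ hφ')).symm
  | succ j =>
    refine ⟨j, ModuleCat.ofHom (koszulContract e (ModuleCat.Hom.hom φ)), ?_⟩
    rw [koszulCochain_d, koszulContract_comp_koszulD _ e _ hφ']
    rfl

variable (S : ObjectProperty (ModuleCat.{u} R)) [S.IsSerreClass]

theorem isGradeFamily_koszul [IsNoetherianRing R] (hy : Ideal.span (Set.range y) = a) :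
    IsGradeFamily S a (fun i M => S ((koszulCochain y M).homology i)) := by
  have hC : ∀ i, Projective ((koszulComplex y).X i) := fun i =>
    (IsProjective.iff_projective (⋀[R]^i (Fin n → R))).1 inferInstance
  refine (isCohomological_homCohomology hC).isGradeFamily 1 (fun i N _ _ _ hN => ?_)
    (fun x hx i M t => ?_) (fun M _ _ => ?_)
  · refine mem_homology _ S i ?_
    exact (mem_iff_of_equiv S (ModuleCat.homLinearEquiv (S := R)
      (M := ModuleCat.of R (⋀[R]^i (Fin n → R))) (N := ModuleCat.of R N))).2 (mem_linearMap S hN)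
  · rw [pow_one]
    exact koszul_smul_eq_zero hy hx i t
  · let φ : Submodule.torsionBySet R M (a : Set R) →ₗ[R] ((⋀[R]^0 (Fin n → R)) →ₗ[R] M) :=
      LinearMap.lcomp R M (exteriorPower.zeroEquiv R (Fin n → R)).toLinearMap ∘ₗ
        (LinearMap.ringLmapEquivSelf R R M).symm.toLinearMap ∘ₗ Submodule.subtype _
    refine exists_injective_homology_zero (koszulCochain y M)
      ((ModuleCat.homLinearEquiv (S := R) (M := ModuleCat.of R (⋀[R]^0 (Fin n → R)))
        (N := ModuleCat.of R M)).symm.toLinearMap ∘ₗ φ) (fun m m' h => ?_) ?_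
    · have h1 : φ m = φ m' := congrArg ModuleCat.Hom.hom h
      have h2 := LinearMap.congr_fun h1 (exteriorPower.ιMulti R 0 fun i => i.elim0)
      exact Subtype.ext (by simpa [φ] using! h2)
    · ext m
      refine (koszulCochain_d_eq_zero_iff y 0 (φ m)).2 ?_
      apply exteriorPower.linearMap_ext
      ext v
      have hv : Fintype.linearCombination R y (v 0) ∈ a := by
        rw [← hy]
        exact (Fintype.range_linearCombination R y).le ⟨v 0, rfl⟩
      have := (Submodule.mem_torsionBySet_iff (a : Set R) (m : M)).1 m.2 ⟨_, hv⟩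
      rw [LinearMap.compAlternatingMap_apply, LinearMap.comp_apply, koszulD_ιMulti]
      simpa [φ] using! this

/-- The top Koszul cohomology module surjects onto `M / aM`, by evaluation of a cochain at
`e₁ ∧ ⋯ ∧ eₙ`. -/
theorem mem_of_koszul_top (hy : Ideal.span (Set.range y) = a)
    (h : S ((koszulCochain y M).homology n)) :
    S (ModuleCat.of R (M ⧸ (a • ⊤ : Submodule R M))) := by
  let ω : ⋀[R]^n (Fin n → R) := exteriorPower.ιMulti R n (Pi.basisFun R (Fin n))
  let ev : ((⋀[R]^n (Fin n → R)) →ₗ[R] M) →ₗ[R] M ⧸ (a • ⊤ : Submodule R M) :=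
    (a • ⊤ : Submodule R M).mkQ ∘ₗ LinearMap.applyₗ ω
  refine mem_of_homology (koszulCochain y M) S n h
    (ev ∘ₗ (ModuleCat.homLinearEquiv (S := R) (M := ModuleCat.of R (⋀[R]^n (Fin n → R)))
        (N := ModuleCat.of R M)).toLinearMap) (fun j ψ => ?_) (fun c => ?_)
  · by_cases hj : j + 1 = n
    · subst hj
      obtain ⟨χ, rfl⟩ : ∃ χ : (⋀[R]^j (Fin (j + 1) → R)) →ₗ[R] M, ModuleCat.ofHom χ = ψ :=
        ⟨ModuleCat.Hom.hom ψ, rfl⟩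
      refine (congrArg _ (koszulCochain_d y j χ)).trans ?_
      change Submodule.mkQ _ (χ (koszulD _ j ω)) = 0
      rw [Submodule.mkQ_apply, Submodule.Quotient.mk_eq_zero, koszulD_ιMulti, map_sum]
      refine Submodule.sum_mem _ fun k _ => ?_
      rw [map_zsmul, map_smul]
      refine zsmul_mem (Submodule.smul_mem_smul ?_ Submodule.mem_top) _
      rw [← hy]
      exact (Fintype.range_linearCombination R y).le ⟨_, rfl⟩
    · rw [HomologicalComplex.shape _ _ _ (by simpa using hj)]
      simp
  · obtain ⟨m, rfl⟩ := Submodule.mkQ_surjective _ c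
    let φ : (⋀[R]^n (Fin n → R)) →ₗ[R] M := LinearMap.toSpanSingleton R M m ∘ₗ
      exteriorPower.alternatingMapLinearEquiv (Pi.basisFun R (Fin n)).det
    refine ⟨ModuleCat.ofHom φ, ?_, ?_⟩
    · -- alternating maps in `n + 1` vectors of `Rⁿ` vanish
      rw [koszulCochain_d_eq_zero_iff]
      apply exteriorPower.linearMap_ext
      refine Module.Basis.ext_alternating (Pi.basisFun R (Fin n)) fun v hv => ?_
      exact absurd (Fintype.card_le_of_injective v hv) (by simp)
    · change Submodule.mkQ _ (φ ω) = Submodule.mkQ _ m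
      rw [show φ ω = exteriorPower.alternatingMapLinearEquiv (Pi.basisFun R (Fin n)).det ω • m
        from rfl, exteriorPower.alternatingMapLinearEquiv_apply_ιMulti, Module.Basis.det_self,
        one_smul]

end Koszul

/-! ### Comparison of the two models of Ext -/

section Comparison

open Opposite Abelian

variable {R : Type u} [CommRing R]

variable {X X' : ModuleCat.{u} R} (P : ProjectiveResolution X) (P' : ProjectiveResolution X')
  (M : ModuleCat.{u} R) (n : ℕ)

/-- The map `Hom(C', M) → Hom(C, M)` given by precomposition with `C → C'`. -/
def homCochainPrecomp {C C' : ChainComplex (ModuleCat.{u} R) ℕ} (φ : C ⟶ C')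
    (M : ModuleCat.{u} R) : C'.linearYonedaObj R M ⟶ C.linearYonedaObj R M :=
  (HomologicalComplex.unopFunctor _ _).map
    (((((linearYoneda R (ModuleCat.{u} R)).obj M).rightOp.mapHomologicalComplex
      (ComplexShape.down ℕ)).map φ).op)

theorem isoExt_inv_naturality (g : X ⟶ X') (φ : ProjectiveResolution.Hom P P' g) :
    (P'.isoExt (R := R) n M).inv ≫ ((_root_.Ext R (ModuleCat.{u} R) n).map g.op).app M =
      HomologicalComplex.homologyMap (homCochainPrecomp φ.hom M) n ≫
        (P.isoExt (R := R) n M).inv := by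
  let F := ((linearYoneda R (ModuleCat.{u} R)).obj M).rightOp
  have h1 := congrArg Quiver.Hom.unop
    (ProjectiveResolution.isoLeftDerivedObj_hom_naturality g P P' φ.hom
      (by simpa using! φ.hom_f_zero_comp_π_f_zero) F n)
  have h2 := congrArg Quiver.Hom.unop
    (HomologicalComplex.homologyOp_hom_naturality (homCochainPrecomp φ.hom M) n)
  change (HomologicalComplex.homologyUnop _ n).hom ≫ (P'.isoLeftDerivedObj F n).hom.unop ≫
    ((F.leftDerived n).map g).unop = _
  refine (congrArg ((HomologicalComplex.homologyUnop _ n).hom ≫ ·) h1).trans ?_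
  refine ((Category.assoc _ _ _).symm.trans ?_).trans (Category.assoc _ _ _)
  exact congrArg (· ≫ (P.isoLeftDerivedObj F n).hom.unop) h2

variable {M n} in
/-- A cocycle of `Hom(P, M)`, as a morphism `Pₙ → M`. -/
def cocycleHom (z : (P.complex.linearYonedaObj R M).cycles n) : P.complex.X n ⟶ M :=
  ((P.complex.linearYonedaObj R M).iCycles n).hom z

theorem d_comp_cocycleHom (z : (P.complex.linearYonedaObj R M).cycles n) :
    P.complex.d (n + 1) n ≫ cocycleHom P z = 0 :=
  LinearMap.congr_fun (congrArg ModuleCat.Hom.hom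
    ((P.complex.linearYonedaObj R M).iCycles_d n (n + 1))) z

theorem cocycleHom_smul (r : R) (z : (P.complex.linearYonedaObj R M).cycles n) :
    cocycleHom P (r • z) = cocycleHom P z ≫ (r • 𝟙 M) := by
  rw [Linear.comp_smul, Category.comp_id]
  exact map_smul _ r z

/-- The class in `Extⁿ(X, M)` of a cocycle of `Hom(P, M)`. -/
def extOfCycles : (P.complex.linearYonedaObj R M).cycles n →ₗ[R] Ext X M n where
  toFun z := P.extMk (cocycleHom P z) (n + 1) rfl (d_comp_cocycleHom P M n z)
  map_add' z w := by
    rw [P.add_extMk]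
    congr 1
    exact map_add _ z w
  map_smul' r z := by
    rw [RingHom.id_apply, Ext.smul_eq_comp_mk₀, P.extMk_comp_mk₀]
    congr 1
    exact cocycleHom_smul P M n r z

theorem extMk_congr {f f' : P.complex.X n ⟶ M} (h : f = f')
    (hf : P.complex.d (n + 1) n ≫ f = 0) (hf' : P.complex.d (n + 1) n ≫ f' = 0) :
    P.extMk f (n + 1) rfl hf = P.extMk f' (n + 1) rfl hf' := by
  subst h
  rfl

/-- In every degree, `extMk` vanishes exactly on coboundaries. -/
theorem extMk_eq_zero_iff_exists (f : P.complex.X n ⟶ M) (hf : P.complex.d (n + 1) n ≫ f = 0) :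
    P.extMk f (n + 1) rfl hf = 0 ↔
      ∃ (j : ℕ) (g : P.complex.X j ⟶ M), P.complex.d n j ≫ g = f := by
  have hzero : ∀ j, j + 1 ≠ n → P.complex.d n j = 0 := fun j hj =>
    P.complex.shape n j (by simpa using hj)
  cases n with
  | zero =>
    constructor
    · intro h
      refine ⟨0, 0, ?_⟩
      rw [← P.extEquivCohomologyClass.apply_eq_iff_eq, P.extEquivCohomologyClass_extMk,
        P.extEquivCohomologyClass_zero, CochainComplex.HomComplex.CohomologyClass.mk_eq_zero_iff,
        CochainComplex.HomComplex.Cocycle.toSingleMk_mem_coboundaries_iff _ _ _ _ _ 1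
          (by simp)] at h
      obtain ⟨g, hg⟩ := h
      have hX : Limits.IsZero (P.cochainComplex.X 1) :=
        P.cochainComplex.isZero_of_isStrictlyLE 0 1 (by simp)
      rw [hX.eq_zero_of_tgt (P.cochainComplex.d _ 1), Limits.zero_comp] at hg
      rw [Limits.comp_zero, ← cancel_epi (P.cochainComplexXIso (-((0 : ℕ) : ℤ)) 0 rfl).hom,
        Limits.comp_zero, hg]
    · rintro ⟨j, g, rfl⟩
      simp
  | succ p =>
    rw [P.extMk_eq_zero_iff f (p + 1 + 1) rfl hf p rfl]
    refine ⟨fun ⟨g, hg⟩ => ⟨p, g, hg⟩, fun ⟨j, g, hg⟩ => ?_⟩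
    by_cases hj : j = p
    · subst hj
      exact ⟨g, hg⟩
    · rw [hzero j (by simpa using hj), Limits.zero_comp] at hg
      exact ⟨0, by rw [Limits.comp_zero, hg]⟩

theorem extOfCycles_surjective : Function.Surjective (extOfCycles P M n) := fun y => by
  obtain ⟨f, hf, rfl⟩ := P.extMk_surjective y (n + 1) rfl
  obtain ⟨z, rfl⟩ := exists_cycles_eq (P.complex.linearYonedaObj R M) n f hf
  exact ⟨z, rfl⟩

theorem extOfCycles_toCycles (j : ℕ) (g : (P.complex.linearYonedaObj R M).X j) :
    extOfCycles P M n (((P.complex.linearYonedaObj R M).toCycles j n).hom g) = 0 := by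
  refine (extMk_eq_zero_iff_exists P M n _ (d_comp_cocycleHom P M n _)).2 ⟨j, g, ?_⟩
  exact (LinearMap.congr_fun (congrArg ModuleCat.Hom.hom
    ((P.complex.linearYonedaObj R M).toCycles_i j n)) g).symm

theorem homologyπ_eq_zero_of_extOfCycles (z : (P.complex.linearYonedaObj R M).cycles n)
    (hz : extOfCycles P M n z = 0) :
    ((P.complex.linearYonedaObj R M).homologyπ n).hom z = 0 := by
  obtain ⟨j, g, hg⟩ := (extMk_eq_zero_iff_exists P M n _ (d_comp_cocycleHom P M n z)).1 hz
  have : ((P.complex.linearYonedaObj R M).toCycles j n).hom g = z := by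
    apply (ModuleCat.mono_iff_injective ((P.complex.linearYonedaObj R M).iCycles n)).1 inferInstance
    exact (LinearMap.congr_fun (congrArg ModuleCat.Hom.hom
      ((P.complex.linearYonedaObj R M).toCycles_i j n)) g).trans hg
  rw [← this]
  exact LinearMap.congr_fun (congrArg ModuleCat.Hom.hom
    ((P.complex.linearYonedaObj R M).toCycles_comp_homologyπ j n)) g

/-- The map `Hⁿ(Hom(P, M)) → Extⁿ(X, M)`. -/
def homologyToExt : (P.complex.linearYonedaObj R M).homology n ⟶ ModuleCat.of R (Ext X M n) :=
  ((P.complex.linearYonedaObj R M).sc n).descHomology (ModuleCat.ofHom (extOfCycles P M n))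
    (by ext g; exact extOfCycles_toCycles P M n _ g)

theorem homologyToExt_homologyπ (z : (P.complex.linearYonedaObj R M).cycles n) :
    (homologyToExt P M n).hom (((P.complex.linearYonedaObj R M).homologyπ n).hom z) =
      extOfCycles P M n z :=
  LinearMap.congr_fun (congrArg ModuleCat.Hom.hom
    (((P.complex.linearYonedaObj R M).sc n).π_descHomology _ _)) z

theorem homologyToExt_bijective : Function.Bijective (homologyToExt P M n).hom := by
  have hπ := (ModuleCat.epi_iff_surjective
    ((P.complex.linearYonedaObj R M).homologyπ n)).1 inferInstance
  constructor
  · rw [injective_iff_map_eq_zero]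
    intro t ht
    obtain ⟨z, rfl⟩ := hπ t
    rw [homologyToExt_homologyπ] at ht
    exact homologyπ_eq_zero_of_extOfCycles P M n z ht
  · intro y
    obtain ⟨z, rfl⟩ := extOfCycles_surjective P M n y
    exact ⟨_, homologyToExt_homologyπ P M n z⟩

variable {P P'} in
theorem homologyToExt_naturality {g : X ⟶ X'} (φ : ProjectiveResolution.Hom P P' g)
    (t : (P'.complex.linearYonedaObj R M).homology n) :
    (homologyToExt P M n).hom
        ((HomologicalComplex.homologyMap (homCochainPrecomp φ.hom M) n).hom t) =
      (Ext.mk₀ g).comp ((homologyToExt P' M n).hom t : Ext X' M n) (zero_add n) := by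
  obtain ⟨z, rfl⟩ := (ModuleCat.epi_iff_surjective
    ((P'.complex.linearYonedaObj R M).homologyπ n)).1 inferInstance t
  have h1 := LinearMap.congr_fun (congrArg ModuleCat.Hom.hom
    (HomologicalComplex.homologyπ_naturality (homCochainPrecomp φ.hom M) n)) z
  refine (congrArg _ h1).trans ?_
  refine (homologyToExt_homologyπ P M n _).trans ?_
  rw [homologyToExt_homologyπ]
  refine Eq.trans ?_ (ProjectiveResolution.mk₀_comp_extMk (cocycleHom P' z) (n + 1) rfl
    (d_comp_cocycleHom P' M n z) φ).symm
  have h2 : cocycleHom P ((HomologicalComplex.cyclesMap (homCochainPrecomp φ.hom M) n).hom z) =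
      φ.hom.f n ≫ cocycleHom P' z := LinearMap.congr_fun (congrArg ModuleCat.Hom.hom
    (HomologicalComplex.cyclesMap_i (homCochainPrecomp φ.hom M) n)) z
  change P.extMk (cocycleHom P
    ((HomologicalComplex.cyclesMap (homCochainPrecomp φ.hom M) n).hom z)) (n + 1) rfl
      (d_comp_cocycleHom P M n _) = _
  exact extMk_congr P M n h2 _ _

variable (R) in
/-- The isomorphism between `Ext` as a left derived functor of `Hom(-, M)` and `Abelian.Ext`. -/
def extEquiv (X M : ModuleCat.{u} R) (n : ℕ) :
    ((_root_.Ext R (ModuleCat.{u} R) n).obj (op X)).obj M ≃ₗ[R] Ext X M n :=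
  ((projectiveResolution X).isoExt (R := R) n M).toLinearEquiv.trans
    (LinearEquiv.ofBijective _ (homologyToExt_bijective (projectiveResolution X) M n))

theorem extEquiv_naturality (g : X ⟶ X')
    (t : ((_root_.Ext R (ModuleCat.{u} R) n).obj (op X')).obj M) :
    extEquiv R X M n ((((_root_.Ext R (ModuleCat.{u} R) n).map g.op).app M).hom t) =
      (Ext.mk₀ g).comp (extEquiv R X' M n t) (zero_add n) := by
  let P := projectiveResolution X
  let P' := projectiveResolution X'
  let φ : ProjectiveResolution.Hom P P' g :=
    { hom := ProjectiveResolution.lift g P P'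
      hom_f_zero_comp_π_f_zero := by
        rw [ChainComplex.single₀_map_f_zero]
        exact ProjectiveResolution.lift_commutes_zero g P P' }
  obtain ⟨s, rfl⟩ := ((P'.isoExt (R := R) n M).toLinearEquiv).symm.surjective t
  have h1 := LinearMap.congr_fun (congrArg ModuleCat.Hom.hom
    (isoExt_inv_naturality P P' M n g φ)) s
  have h2 := homologyToExt_naturality M n φ s
  have e1 : extEquiv R X M n ((P.isoExt (R := R) n M).inv.hom
      ((HomologicalComplex.homologyMap (homCochainPrecomp φ.hom M) n).hom s)) =
      (homologyToExt P M n).hom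
        ((HomologicalComplex.homologyMap (homCochainPrecomp φ.hom M) n).hom s) :=
    congrArg (homologyToExt P M n).hom
      ((P.isoExt (R := R) n M).toLinearEquiv.apply_symm_apply _)
  have e2 : extEquiv R X' M n ((P'.isoExt (R := R) n M).toLinearEquiv.symm s) =
      (homologyToExt P' M n).hom s :=
    congrArg (homologyToExt P' M n).hom
      ((P'.isoExt (R := R) n M).toLinearEquiv.apply_symm_apply s)
  rw [e2]
  exact ((congrArg (extEquiv R X M n) h1).trans e1).trans h2

end Comparison

/-! ### Local cohomology -/

section LocalCohomology

open Opposite Abelian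

variable {R : Type u} [CommRing R] (S : ObjectProperty (ModuleCat.{u} R)) [S.IsSerreClass]

/-- A module covered by the images of modules in `S` is in `S`, when `S` is closed under direct
sums. -/
theorem mem_of_jointly_surjective (hS : ClosedUnderDirectSums S) {ι : Type}
    (N : ι → ModuleCat.{u} R) (hN : ∀ i, S (N i)) {L : Type u} [AddCommGroup L] [Module R L]
    (f : ∀ i, N i →ₗ[R] L) (hf : ∀ y, ∃ i x, f i x = y) : S (ModuleCat.of R L) := by
  classical
  refine mem_of_surjective S
    (DirectSum.toModule R (ULift.{u} ι) L (φ := fun i => f i.down)) (fun y => ?_)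
    (hS (ULift.{u} ι) (fun i => N i.down) fun i => hN i.down)
  obtain ⟨i, x, rfl⟩ := hf y
  exact ⟨DirectSum.lof R (ULift.{u} ι) (fun i => N i.down) ⟨i⟩ x, DirectSum.toModule_lof R _ _⟩

variable (a : Ideal R) (M : ModuleCat.{u} R) (i : ℕ)

/-- The directed system of the `Extⁱ(R ⧸ aᵐ, M)`. -/
def extSystem : ℕᵒᵖᵒᵖ ⥤ ModuleCat.{u} R :=
  localCohomology.diagram (localCohomology.idealPowersDiagram a) i ⋙
    (evaluation (ModuleCat.{u} R) (ModuleCat.{u} R)).obj M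

/-- Local cohomology as a cocone over the modules `Extⁱ(R ⧸ aᵐ, M)`. -/
def extCocone : Limits.Cocone (extSystem a M i) :=
  ((evaluation (ModuleCat.{u} R) (ModuleCat.{u} R)).obj M).mapCocone
    (Limits.colimit.cocone (localCohomology.diagram (localCohomology.idealPowersDiagram a) i))

/-- Local cohomology is the colimit of the modules `Extⁱ(R ⧸ aᵐ, M)`. -/
def isColimitExtCocone : Limits.IsColimit (extCocone a M i) :=
  Limits.isColimitOfPreserves _ (Limits.colimit.isColimit _)

instance preservesColimit_forget_extSystem :
    Limits.PreservesColimit (extSystem a M i) (forget (ModuleCat.{u} R)) :=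
  have : Limits.PreservesFilteredColimitsOfSize.{0, 0} (forget (ModuleCat.{u} R)) :=
    Limits.preservesFilteredColimitsOfSize_shrink.{0, u, 0, u} _
  inferInstance

/-- The transition map `R ⧸ a^m' → R ⧸ a^m`. -/
def transition {j k : ℕᵒᵖᵒᵖ} (f : j ⟶ k) :
    ModuleCat.of R (R ⧸ a ^ k.unop.unop) ⟶ ModuleCat.of R (R ⧸ a ^ j.unop.unop) :=
  (localCohomology.ringModIdeals (localCohomology.idealPowersDiagram a)).map f.unop

theorem transition_surjective {j k : ℕᵒᵖᵒᵖ} (f : j ⟶ k) :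
    Function.Surjective (transition a f).hom := fun c => by
  obtain ⟨r, rfl⟩ := Submodule.mkQ_surjective _ c
  exact ⟨Submodule.Quotient.mk r, rfl⟩

/-- The terms of the directed system are the modules `Extⁱ(R ⧸ aᵐ, M)`. -/
def extSystemEquiv (j : ℕᵒᵖᵒᵖ) :
    (extSystem a M i).obj j ≃ₗ[R] Ext (ModuleCat.of R (R ⧸ a ^ j.unop.unop)) M i :=
  extEquiv R _ M i

theorem extSystemEquiv_map {j k : ℕᵒᵖᵒᵖ} (f : j ⟶ k) (t : (extSystem a M i).obj j) :
    extSystemEquiv a M i k (((extSystem a M i).map f).hom t) =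
      (Ext.mk₀ (transition a f)).comp (extSystemEquiv a M i j t) (zero_add i) :=
  extEquiv_naturality M i (transition a f) t

variable {S a M i}

theorem mem_localCohomology (hS : ClosedUnderDirectSums S)
    (h : ∀ m, S (ModuleCat.of R (Ext (ModuleCat.of R (R ⧸ a ^ m)) M i))) :
    S ((localCohomology a i).obj M) := by
  refine mem_of_jointly_surjective S hS (fun j => (extSystem a M i).obj j) (fun j => ?_)
    (fun j => ((extCocone a M i).ι.app j).hom) (fun y => ?_)
  · exact (mem_iff_of_equiv S (extSystemEquiv a M i j)).2 (h _)
  · exact Limits.Concrete.isColimit_exists_rep _ (isColimitExtCocone a M i) y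

/-- If `Extⁱ⁻¹(N, M)` is in `S` for the kernels `N` of `R ⧸ aᵐ → R ⧸ a`, then so is the kernel of
`Extⁱ(R ⧸ a, M) → Hⁱ(M)`, which is the union of those of `Extⁱ(R ⧸ a, M) → Extⁱ(R ⧸ aᵐ, M)`. -/
theorem mem_ext_of_localCohomology (hS : ClosedUnderDirectSums S)
    (h : ∀ (k : ℕᵒᵖᵒᵖ) (f : op (op 1) ⟶ k) (l : ℕ), l + 1 = i → S (ModuleCat.of R
      (Ext (ModuleCat.of R (LinearMap.ker (transition a f).hom)) M l)))
    (hH : S ((localCohomology a i).obj M)) :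
    S (ModuleCat.of R (Ext (ModuleCat.of R (R ⧸ a)) M i)) := by
  let F := extSystem a M i
  let j : ℕᵒᵖᵒᵖ := op (op 1)
  suffices hj : S (F.obj j) by
    have h1 := (mem_iff_of_equiv S (extSystemEquiv a M i j)).1 hj
    have key : ∀ b : Ideal R, b = a → S (ModuleCat.of R (Ext (ModuleCat.of R (R ⧸ b)) M i)) →
      S (ModuleCat.of R (Ext (ModuleCat.of R (R ⧸ a)) M i)) := by rintro b rfl h; exact h
    exact key _ (pow_one a) h1
  refine mem_of_ker S ((extCocone a M i).ι.app j).hom ?_ hH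
  refine mem_of_jointly_surjective S hS (ι := Σ k, (j ⟶ k))
    (fun p => ModuleCat.of R (LinearMap.ker (F.map p.2).hom)) ?_
    (fun p => Submodule.inclusion fun t ht => ?_) ?_
  · rintro ⟨k, f⟩
    have hX := moduleCat_shortExact (LinearMap.ker (transition a f).hom).subtype
      (transition a f).hom Subtype.val_injective (transition_surjective a f) (fun x => by simp)
    -- transport the kernel to `Abelian.Ext`
    let ρ := (Ext.mk₀ (transition a f)).precompOfLinear R M (zero_add i)
    suffices hρ : S (ModuleCat.of R (LinearMap.ker ρ)) by
      refine mem_of_injective S (LinearMap.restrict (extSystemEquiv a M i j).toLinearMap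
        (p := LinearMap.ker (F.map f).hom) (q := LinearMap.ker ρ) fun t ht => ?_) ?_ hρ
      · have h1 := extSystemEquiv_map a M i f t
        rw [show ((extSystem a M i).map f).hom t = 0 from ht, map_zero] at h1
        exact h1.symm
      · intro t t' htt
        have h2 : extSystemEquiv a M i j t = extSystemEquiv a M i j t' :=
          congrArg (LinearMap.ker ρ).subtype htt
        exact Subtype.ext ((extSystemEquiv a M i j).injective h2)
    cases i with
    | zero =>
      have : Epi (transition a f) := (ModuleCat.epi_iff_surjective _).2 (transition_surjective a f)
      have : Subsingleton (LinearMap.ker ρ) := by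
        rw [Submodule.subsingleton_iff_eq_bot, LinearMap.ker_eq_bot]
        exact Ext.precomp_mk₀_injective_of_epi M (transition a f)
      exact mem_of_subsingleton S
    | succ l =>
      refine mem_ker_of_exact (hX.extClass.precompOfLinear R M (add_comm 1 l)) ρ (fun y => ?_)
        (h k f l rfl)
      constructor
      · exact fun hy => Ext.contravariant_sequence_exact₃ hX M y hy (add_comm 1 l)
      · rintro ⟨z, rfl⟩
        exact hX.comp_extClass_assoc z (add_comm 1 l)
  · have h1 := LinearMap.congr_fun (congrArg ModuleCat.Hom.hom ((extCocone a M i).w p.2)) t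
    change ((extCocone a M i).ι.app j).hom t = 0
    rw [← h1]
    change ((extCocone a M i).ι.app p.1).hom ((F.map p.2).hom t) = 0
    rw [LinearMap.mem_ker.1 ht, map_zero]
  · rintro ⟨t, ht⟩
    obtain ⟨k, f, g, hfg⟩ := Limits.Concrete.isColimit_exists_of_rep_eq (D := extCocone a M i)
      (extSystem a M i)
      (isColimitExtCocone a M i) t (0 : F.obj j) (by
        rw [map_zero]
        exact ht)
    rw [map_zero] at hfg
    exact ⟨⟨k, f⟩, ⟨t, hfg⟩, rfl⟩

end LocalCohomology

/-! ### Comparison of the grades -/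

section Main

open Abelian

variable {R : Type u} [CommRing R] [IsNoetherianRing R]
  {S : ObjectProperty (ModuleCat.{u} R)} [S.IsSerreClass] {a : Ideal R}

/-- Two families of properties which agree in each degree below which the first holds have the same
first failure. -/
theorem sInf_not_eq_of_iff {P Q : ℕ → Prop} (h : ∀ t, (∀ i < t, P i) → (P t ↔ Q t)) :
    sInf {e : ℕ∞ | ∃ i : ℕ, e = i ∧ ¬ P i} = sInf {e : ℕ∞ | ∃ i : ℕ, e = i ∧ ¬ Q i} := by
  have key : ∀ n, (∀ i < n, P i) ↔ ∀ i < n, Q i := fun n => by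
    induction n with
    | zero => simp
    | succ n ih =>
      simp only [Nat.lt_succ_iff_lt_or_eq, or_imp, forall_and, forall_eq, ← ih]
      exact and_congr_right fun hn => h n hn
  have aux : ∀ (P : ℕ → Prop) (n : ℕ), (n : ℕ∞) ≤ sInf {e : ℕ∞ | ∃ i : ℕ, e = i ∧ ¬ P i} ↔
      ∀ i < n, P i := fun P n => by
    constructor
    · intro hn i hi
      by_contra hP
      exact absurd hi (by simpa using hn.trans (sInf_le ⟨i, rfl, hP⟩))
    · intro hP
      refine le_sInf ?_
      rintro _ ⟨i, rfl, hi⟩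
      by_contra hc
      exact hi (hP i (by simpa using hc))
  exact ENat.eq_of_forall_natCast_le_iff fun n => by rw [aux, aux, key]

theorem ext_mem_iff_localCohomology_mem (hS : ClosedUnderDirectSums S)
    (M : Type u) [AddCommGroup M] [Module R M] [Module.Finite R M] (t : ℕ)
    (h : ∀ i < t, S (ModuleCat.of R (Ext (ModuleCat.of R (R ⧸ a)) (ModuleCat.of R M) i))) :
    S (ModuleCat.of R (Ext (ModuleCat.of R (R ⧸ a)) (ModuleCat.of R M) t)) ↔
      S ((localCohomology a t).obj (ModuleCat.of R M)) := by
  have hpow : ∀ m : ℕ, ∀ x ∈ a, ∀ n : R ⧸ a ^ m, x ^ m • n = 0 := fun m x hx n => by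
    obtain ⟨r, rfl⟩ := Ideal.Quotient.mk_surjective n
    exact Ideal.Quotient.eq_zero_iff_mem.2 ((a ^ m).mul_mem_right r (Ideal.pow_mem_pow hx m))
  constructor
  · intro ht
    obtain ⟨xs, hlen, hxa, hxs⟩ := (isGradeFamily_ext (S := S) (a := a)).exists_isWeakSeq M (t + 1)
      fun i hi => by
        rcases Nat.lt_succ_iff_lt_or_eq.1 hi with hi | rfl
        exacts [h i hi, ht]
    exact mem_localCohomology hS fun m =>
      (isVanishing_ext (R ⧸ a ^ m) m (hpow m)).of_isWeakSeq M xs hxa hxs t (by omega)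
  · obtain ⟨xs, hlen, hxa, hxs⟩ := (isGradeFamily_ext (S := S) (a := a)).exists_isWeakSeq M t h
    refine mem_ext_of_localCohomology hS fun k f l hl => ?_
    exact (isVanishing_ext (LinearMap.ker (transition a f).hom) k.unop.unop
      (fun x hx n => Subtype.ext (hpow k.unop.unop x hx (n : R ⧸ a ^ k.unop.unop)))).of_isWeakSeq M xs hxa hxs l (by omega)

omit [IsNoetherianRing R] in
theorem seqSubmodule_le (M : Type u) [AddCommGroup M] [Module R M] {xs : List R}
    (hxs : ∀ r ∈ xs, r ∈ a) : seqSubmodule M xs ≤ a • ⊤ :=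
  Submodule.smul_mono_left (Ideal.span_le.2 hxs)

omit [IsNoetherianRing R] in
/-- If `M / aM ∉ S`, every weak sequence in `a` is a sequence, since `M / aM` is a quotient of
`M / (xs)M`. -/
theorem isMaximalIn_isWeakSeq_of_isSeq {M : Type u} [AddCommGroup M] [Module R M]
    (hM : ¬ S (ModuleCat.of R (M ⧸ (a • ⊤ : Submodule R M)))) {xs : List R}
    (h : IsMaximalIn a (IsSeq S M) xs) : IsMaximalIn a (IsWeakSeq S M) xs :=
  ⟨h.1, h.2.1.1, fun ys hya hys hpre => h.2.2 ys hya ⟨hys, fun hS => hM <|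
    mem_of_surjective S (Submodule.factor (seqSubmodule_le M hya))
      (Submodule.factor_surjective (seqSubmodule_le M hya)) hS⟩ hpre⟩

end Main

end SerreGrade

end

theorem theorem2p8 {R : Type u} [CommRing R] [IsNoetherianRing R]
    (S : ObjectProperty (ModuleCat.{u} R)) [S.IsSerreClass] (a : Ideal R)
    (M : Type u) [AddCommGroup M] [Module R M] [Module.Finite R M] :
    -- the length of a maximal weak sequence is the Ext grade
    (∀ x : List R, SerreGrade.IsMaximalIn a (SerreGrade.IsWeakSeq S M) x →
      (x.length : ℕ∞) = SerreGrade.eGrade S a M) ∧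
    -- the classical, Ext and Koszul grades agree
    (SerreGrade.cGrade S a M = SerreGrade.eGrade S a M ∧
      ∀ (n : ℕ) (y : Fin n → R), Ideal.span (Set.range y) = a →
        SerreGrade.eGrade S a M = SerreGrade.kGrade S M y) ∧
    -- the Ext and local cohomology grades agree
    (SerreGrade.ClosedUnderDirectSums S →
      SerreGrade.eGrade S a M = SerreGrade.hGrade S a M) ∧
    -- finiteness, and the common length of the maximal sequences
    (¬ S (ModuleCat.of R (M ⧸ (a • ⊤ : Submodule R M))) →
      (∀ (n : ℕ) (y : Fin n → R), Ideal.span (Set.range y) = a →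
        SerreGrade.kGrade S M y < ⊤) ∧
      ∃ l : ℕ, ∀ x : List R, SerreGrade.IsMaximalIn a (SerreGrade.IsSeq S M) x →
        x.length = l) := by
  have hE := SerreGrade.isGradeFamily_ext (S := S) (a := a)
  refine ⟨hE.length_eq_of_isMaximalIn M, ⟨hE.cGrade_eq M, fun n y hy => ?_⟩, fun hS => ?_,
    fun hM => ⟨fun n y hy => ?_, (SerreGrade.eGrade S a M).toNat, fun x hx => ?_⟩⟩
  · exact (hE.cGrade_eq M).symm.trans ((SerreGrade.isGradeFamily_koszul S hy).cGrade_eq M)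
  · exact SerreGrade.sInf_not_eq_of_iff (SerreGrade.ext_mem_iff_localCohomology_mem hS M)
  · exact lt_of_le_of_lt (sInf_le ⟨n, rfl, fun h => hM (SerreGrade.mem_of_koszul_top S hy h)⟩)
      (ENat.natCast_lt_top n)
  · have h := hE.length_eq_of_isMaximalIn M x (SerreGrade.isMaximalIn_isWeakSeq_of_isSeq hM hx)
    change (x.length : ℕ∞) = SerreGrade.eGrade S a M at h
    rw [← h, ENat.toNat_natCast]
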